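/- Let $\lambda>0$. On $L^2(\mathbb R)$ let $(S_\lambda\psi)(x)=\psi(x-\frac1\lambda)$, and let $\mathcal F$ be the unitary Fourier transform, $(\mathcal F\psi)(k)=\frac1{\sqrt{2\pi}}\int_{\mathbb R}e^{-ikx}\psi(x)\,dx$. Let $\Pi$, with domain $D_0$, be the closure of the operator $f\mapsto i\,(xf+x^2f')$ on the Schwartz space $\mathcal S(\mathbb R)$; put $\zeta_\theta(x)=\frac1x e^{-1/|x|}e^{i\,\mathrm{sgn}(x)\theta/2}$, and let $\Pi_0$ be the extension of $\Pi$ to $D_0+\mathbb C\zeta_0$ given by $\Pi_0(\psi+c\,\zeta_0)=\Pi\psi+c\,\zeta_\pi$. The one-dimensional thermal Hamiltonian is $H_T=\lambda\,(\mathcal FS_\lambda)^*\,\Pi_0\,(\mathcal FS_\lambda)$ with domain $D(H_T)=(\mathcal FS_\lambda)^*[D_0+\mathbb C\zeta_0]$; it is self-adjoint. **Theorem (scattering for convolution perturbations in $d=1$).** Let $g\in L^1(\mathbb R)$ be complex-valued with $g(-x)=\overline{g(x)}$ for almost every $x$ (equivalently, the bounded convolution operator $(W_g\psi)(x)=\int_{\mathbb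 R}g(x-y)\psi(y)\,dy$ on $L^2(\mathbb R)$ is symmetric), and let $H_{T,g}=H_T+W_g$. Then: (i) $H_{T,g}$ is self-adjoint with domain $D(H_T)$, its spectrum is purely absolutely continuous (its absolutely continuous subspace is all of $L^2(\mathbb R)$), and $\sigma(H_{T,g})=\sigma_{\rm a.c.}(H_{T,g})=\mathbb R$. Let $\hat g(k)=\frac1{\sqrt{2\pi}}\int_{\mathbb R}e^{-ikx}g(x)\,dx$, and assume moreover that there are constants $\varepsilon>0$ and $C>0$ such that $|\hat g(x)|\le C|x|^{3/2}$ for all $|x|<\varepsilon$. Then: (ii) the wave operators $\Omega_g^{\pm}=\mathrm{s}\text{-}\lim_{t\to\pm\infty}e^{itH_{T,g}}e^{-itH_T}$ exist and are complete, i.e. the range of each of them is the absolutely continuous subspace of $H_{T,g}$; (iii) the function $s\mapsto\hat g(s)/s^2$ is integrable on $\mathbb R$, and the $S$-matrix $S_g=(\Omega_g^+)^*\Omega_g^-$ is the constant phase (a complex number of modulus $1$ times the identity) $$S_g=\exp\Big(-i\,\frac{\sqrt{2\pi}}{\lambda}\int_{\mathbb R}\frac{\hat g(s)}{s^2}\,ds\Big)\,\mathbf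 1 .$$ -/

import Mathlib

open MeasureTheory Filter Topology
open scoped SchwartzMap ENNReal ComplexConjugate

namespace Thermal

noncomputable section

/-! ### Unbounded operators: spectrum, parts, unitary conjugation, propagators -/

section Abstract

/-- The resolvent set of a (partially defined) linear operator `A`: the complex numbers `z` such
that `A - z` is a bijection from the domain of `A` onto the space, with bounded inverse `R`. -/
def opResolventSet {E : Type*} [NormedAddCommGroup E] [NormedSpace ℂ E] (A : E →ₗ.[ℂ] E) : Set ℂ :=
  {z | ∃ R : E →L[ℂ] E, ∀ φ ψ : E, (φ, ψ + z • φ) ∈ A.graph ↔ φ = R ψ}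

/-- The spectrum of a (partially defined) linear operator. -/
def opSpectrum {E : Type*} [NormedAddCommGroup E] [NormedSpace ℂ E] (A : E →ₗ.[ℂ] E) : Set ℂ :=
  (opResolventSet A)ᶜ

variable {H : Type*} [NormedAddCommGroup H] [InnerProductSpace ℂ H]

/-- The part of `A` in a subspace `K`: its domain is the set of the `ψ ∈ K ∩ D(A)` with
`A ψ ∈ K`, and it acts there as `A`. -/
def part (A : H →ₗ.[ℂ] H) (K : Submodule ℂ H) : K →ₗ.[ℂ] K :=
  (A.graph.comap (K.subtype.prodMap K.subtype)).toLinearPMap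

/-- The conjugated operator `U* A U` with domain `U* D(A)`, for a unitary `U`. -/
def unitaryConj (U : H ≃ₗᵢ[ℂ] H) (A : H →ₗ.[ℂ] H) : H →ₗ.[ℂ] H where
  domain := A.domain.comap (U : H →ₗ[ℂ] H)
  toFun := (U.symm : H →ₗ[ℂ] H) ∘ₗ A.toFun ∘ₗ
    (U : H →ₗ[ℂ] H).restrict (p := A.domain.comap (U : H →ₗ[ℂ] H)) (q := A.domain) fun _ hx => hx

/-- `U` is the propagator `t ↦ exp (-i t A)` of `A`: a strongly continuous one-parameter unitary
group whose infinitesimal generator (domain included) is `-i A`. -/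
structure IsPropagator (A : H →ₗ.[ℂ] H) (U : ℝ → (H ≃ₗᵢ[ℂ] H)) : Prop where
  map_add : ∀ (s t : ℝ) (ψ : H), U (s + t) ψ = U s (U t ψ)
  continuous : ∀ ψ : H, Continuous fun t => U t ψ
  generator : ∀ ψ φ : H,
    (ψ, φ) ∈ A.graph ↔ HasDerivAt (fun t => U t ψ) (-Complex.I • φ) 0

/-- `Ω` is the strong limit of `exp (i t B) exp (-i t A)` as `t` tends along `l`, where
`U t = exp (-i t A)` and `V t = exp (-i t B)`. -/
def IsWaveOperator (U V : ℝ → (H ≃ₗᵢ[ℂ] H)) (l : Filter ℝ) (Ω : H →L[ℂ] H) : Prop :=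
  ∀ ψ : H, Tendsto (fun t => V (-t) (U t ψ)) l (𝓝 (Ω ψ))

end Abstract

/-! ### Spectral measures -/

section Spectral

/-- A projection-valued measure on the Borel sets of `ℝ` (the values on non-measurable sets are
irrelevant). -/
structure PVM (H : Type*) [NormedAddCommGroup H] [InnerProductSpace ℂ H] [CompleteSpace H] where
  proj : Set ℝ → (H →L[ℂ] H)
  isSelfAdjoint : ∀ B, MeasurableSet B → IsSelfAdjoint (proj B)
  inter : ∀ B C, MeasurableSet B → MeasurableSet C → proj (B ∩ C) = proj B * proj C
  univ : proj Set.univ = 1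
  iUnion : ∀ f : ℕ → Set ℝ, (∀ n, MeasurableSet (f n)) → Pairwise (Function.onFun Disjoint f) →
    ∀ ψ : H, HasSum (fun n => proj (f n) ψ) (proj (⋃ n, f n) ψ)

variable {H : Type*} [NormedAddCommGroup H] [InnerProductSpace ℂ H] [CompleteSpace H]

namespace PVM

theorem proj_empty (E : PVM H) : E.proj ∅ = 0 := by
  ext ψ
  have h := E.iUnion (fun _ => ∅) (fun _ => MeasurableSet.empty)
    (fun _ _ _ => disjoint_bot_left) ψ
  have h0 := h.summable.tendsto_atTop_zero
  simpa using tendsto_nhds_unique tendsto_const_nhds h0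

theorem inner_proj (E : PVM H) {B : Set ℝ} (hB : MeasurableSet B) (ψ : H) :
    inner ℂ ψ (E.proj B ψ) = ((‖E.proj B ψ‖ ^ 2 : ℝ) : ℂ) := by
  have h1 : E.proj B ψ = E.proj B (E.proj B ψ) := by
    conv_lhs => rw [← Set.inter_self B, E.inter B B hB hB]
    rfl
  have h2 := (E.isSelfAdjoint B hB).isSymmetric ψ (E.proj B ψ)
  rw [h1]
  refine h2.symm.trans ?_
  rw [← h1]
  exact inner_self_eq_norm_sq_to_K (𝕜 := ℂ) (E.proj B ψ) |>.trans (by norm_cast)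

/-- The scalar spectral measure `B ↦ ‖E(B) ψ‖² = ⟨ψ, E(B) ψ⟩` of the vector `ψ`. -/
def measure (E : PVM H) (ψ : H) : Measure ℝ :=
  Measure.ofMeasurable (fun B _ => ENNReal.ofReal (‖E.proj B ψ‖ ^ 2))
    (by simp [E.proj_empty])
    (by
      intro f hf hd
      have h := E.iUnion f hf hd ψ
      have h1 := h.mapL (innerSL ℂ ψ)
      simp only [innerSL_apply_apply, E.inner_proj (hf _),
        E.inner_proj (MeasurableSet.iUnion hf)] at h1
      have h2 : HasSum (fun n => ‖E.proj (f n) ψ‖ ^ 2) (‖E.proj (⋃ n, f n) ψ‖ ^ 2) := by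
        exact_mod_cast h1
      rw [← h2.tsum_eq, ENNReal.ofReal_tsum_of_nonneg (fun _ => sq_nonneg _) h2.summable])

theorem measure_apply (E : PVM H) (ψ : H) {B : Set ℝ} (hB : MeasurableSet B) :
    E.measure ψ B = ENNReal.ofReal (‖E.proj B ψ‖ ^ 2) :=
  Measure.ofMeasurable_apply B hB

theorem absolutelyContinuous_iff (E : PVM H) (ψ : H) :
    E.measure ψ ≪ volume ↔ ∀ B, MeasurableSet B → volume B = 0 → E.proj B ψ = 0 := by
  constructor
  · intro h B hB h0
    have := h h0
    rw [E.measure_apply ψ hB, ENNReal.ofReal_eq_zero] at this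
    exact norm_eq_zero.1 (pow_eq_zero_iff two_ne_zero |>.1 (le_antisymm this (sq_nonneg _)))
  · intro h
    refine Measure.AbsolutelyContinuous.mk fun B hB h0 => ?_
    rw [E.measure_apply ψ hB, h B hB h0]
    simp

/-- The absolutely continuous subspace: the vectors whose scalar spectral measure is absolutely
continuous with respect to Lebesgue measure. -/
def acSubspace (E : PVM H) : Submodule ℂ H where
  carrier := {ψ | E.measure ψ ≪ volume}
  zero_mem' := (E.absolutelyContinuous_iff 0).2 fun B _ _ => map_zero _
  add_mem' {ψ φ} hψ hφ := (E.absolutelyContinuous_iff _).2 fun B hB h0 => by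
    rw [map_add, (E.absolutelyContinuous_iff ψ).1 hψ B hB h0,
      (E.absolutelyContinuous_iff φ).1 hφ B hB h0, add_zero]
  smul_mem' c ψ hψ := (E.absolutelyContinuous_iff _).2 fun B hB h0 => by
    rw [map_smul, (E.absolutelyContinuous_iff ψ).1 hψ B hB h0, smul_zero]

/-- `E` is the spectral measure of the operator `A`, i.e. `A = ∫ x dE(x)`: the domain of `A` is
the set of the `ψ` with `∫ x² d‖E(x) ψ‖² < ∞`, and `⟨ψ, A ψ⟩ = ∫ x d‖E(x) ψ‖²` there. -/
structure IsSpectralMeasure (E : PVM H) (A : H →ₗ.[ℂ] H) : Prop where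
  mem_domain_iff : ∀ ψ : H,
    ψ ∈ A.domain ↔ ∫⁻ x, ENNReal.ofReal (x ^ 2) ∂(E.measure ψ) < ∞
  inner_apply : ∀ ψ : A.domain,
    inner ℂ (ψ : H) (A ψ) = ((∫ x, x ∂(E.measure (ψ : H)) : ℝ) : ℂ)

end PVM

end Spectral

/-! ### Unitary operators on `L²(ℝ)` -/

/-- The Hilbert space `L²(ℝ)` of complex functions. -/
abbrev L2 : Type := Lp ℂ 2 (volume : Measure ℝ)

theorem memLp_comp_mul {a : ℝ} (ha : a ≠ 0) {f : ℝ → ℂ} (hf : MemLp f 2 volume) :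
    MemLp (fun x => f (a * x)) 2 volume := by
  refine MemLp.comp_of_map (f := fun x => a * x) ?_ (by fun_prop)
  rw [Real.map_volume_mul_left ha]
  exact hf.smul_measure ENNReal.ofReal_ne_top

theorem ae_comp_mul {a : ℝ} (ha : a ≠ 0) {p : ℝ → Prop} (h : ∀ᵐ x, p x) :
    ∀ᵐ x, p (a * x) := by
  have : ∀ᵐ x ∂(Measure.map (fun x => a * x) volume), p x := by
    rw [Real.map_volume_mul_left ha]
    exact Measure.ae_smul_measure h _
  exact ae_of_ae_map (by fun_prop) this

theorem memLp_dilation {a : ℝ} (ha : 0 < a) (ψ : L2) :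
    MemLp (fun x => ((√a : ℝ) : ℂ) * ψ (a * x)) 2 volume :=
  (memLp_comp_mul ha.ne' (Lp.memLp ψ)).const_smul ((√a : ℝ) : ℂ)

/-- `(D ψ)(x) = √a ψ(a x)` as a linear map of `L²(ℝ)`. -/
def dilationₗ (a : ℝ) (ha : 0 < a) : L2 →ₗ[ℂ] L2 where
  toFun ψ := (memLp_dilation ha ψ).toLp (fun x => ((√a : ℝ) : ℂ) * ψ (a * x))
  map_add' ψ φ := by
    rw [← MemLp.toLp_add]
    refine MemLp.toLp_congr _ _ ?_
    filter_upwards [ae_comp_mul ha.ne' (Lp.coeFn_add ψ φ)] with x hx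
    simp only [hx, Pi.add_apply, mul_add]
  map_smul' c ψ := by
    rw [RingHom.id_apply, ← MemLp.toLp_const_smul]
    refine MemLp.toLp_congr _ _ ?_
    filter_upwards [ae_comp_mul ha.ne' (Lp.coeFn_smul c ψ)] with x hx
    simp only [hx, Pi.smul_apply, smul_eq_mul]
    ring

theorem coeFn_dilationₗ (a : ℝ) (ha : 0 < a) (ψ : L2) :
    dilationₗ a ha ψ =ᵐ[volume] fun x => ((√a : ℝ) : ℂ) * ψ (a * x) :=
  MemLp.coeFn_toLp (memLp_dilation ha ψ)

theorem dilationₗ_inv (a b : ℝ) (ha : 0 < a) (hb : 0 < b) (hab : b * a = 1) (ψ : L2) :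
    dilationₗ a ha (dilationₗ b hb ψ) = ψ := by
  refine Lp.ext ?_
  filter_upwards [coeFn_dilationₗ a ha (dilationₗ b hb ψ),
    ae_comp_mul ha.ne' (coeFn_dilationₗ b hb ψ)] with x h1 h2
  rw [h1, h2, ← mul_assoc b a x, hab, one_mul, ← mul_assoc, ← Complex.ofReal_mul,
    ← Real.sqrt_mul ha.le, mul_comm a b, hab]
  simp

/-- The unitary dilation `(D ψ)(x) = √a ψ(a x)` of `L²(ℝ)`, for `a > 0`. -/
def dilation (a : ℝ) (ha : 0 < a) : L2 ≃ₗᵢ[ℂ] L2 where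
  toLinearEquiv := LinearEquiv.ofLinearMap (dilationₗ a ha) (dilationₗ a⁻¹ (inv_pos.2 ha))
    (LinearMap.ext fun ψ => dilationₗ_inv _ _ ha (inv_pos.2 ha) (inv_mul_cancel₀ ha.ne') ψ)
    (LinearMap.ext fun ψ => dilationₗ_inv _ _ (inv_pos.2 ha) ha (mul_inv_cancel₀ ha.ne') ψ)
  norm_map' ψ := by
    have key : ∀ φ : L2, ‖φ‖ ^ 2 = ∫ x, ‖φ x‖ ^ 2 := fun φ => by
      have h := L2.inner_def (𝕜 := ℂ) φ φ
      have h2 : inner ℂ φ φ = ((‖φ‖ ^ 2 : ℝ) : ℂ) := by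
        rw [inner_self_eq_norm_sq_to_K]; norm_cast
      have h3 : ∀ x, inner ℂ (φ x) (φ x) = ((‖φ x‖ ^ 2 : ℝ) : ℂ) := fun x => by
        rw [inner_self_eq_norm_sq_to_K]; norm_cast
      simp only [h2, h3] at h
      rw [integral_complex_ofReal] at h
      exact_mod_cast h
    have h : ‖dilationₗ a ha ψ‖ ^ 2 = ‖ψ‖ ^ 2 := by
      rw [key, key]
      rw [integral_congr_ae (g := fun x => a * (fun y => ‖ψ y‖ ^ 2) (a * x))]
      · rw [integral_const_mul,
          Measure.integral_comp_mul_left (fun y => ‖ψ y‖ ^ 2) a, abs_of_pos (inv_pos.2 ha),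
          smul_eq_mul, ← mul_assoc, mul_inv_cancel₀ ha.ne', one_mul]
      · filter_upwards [coeFn_dilationₗ a ha ψ] with x hx
        rw [hx, norm_mul, mul_pow, Complex.norm_real, Real.norm_eq_abs, sq_abs, Real.sq_sqrt ha.le]
    exact (pow_left_inj₀ (norm_nonneg _) (norm_nonneg _) two_ne_zero).1 h

/-- The unitary Fourier transform, `(F ψ)(k) = (2π)^{-1/2} ∫ e^{-ikx} ψ(x) dx` for integrable `ψ`.
Mathlib's transform has the kernel `e^{-2πikx}`, hence the dilation by `1/(2π)`. -/
def fourierL2 : L2 ≃ₗᵢ[ℂ] L2 :=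
  (Lp.fourierTransformₗᵢ ℝ ℂ).trans (dilation (2 * Real.pi)⁻¹ (by positivity))

/-- The translation `(S ψ)(x) = ψ(x - 1/λ)`, as a unitary operator. -/
def translation (lam : ℝ) : L2 ≃ₗᵢ[ℂ] L2 where
  toFun := Lp.compMeasurePreserving (fun x => x - 1 / lam)
    (measurePreserving_sub_right volume (1 / lam))
  invFun := Lp.compMeasurePreserving (fun x => x + 1 / lam)
    (measurePreserving_add_right volume (1 / lam))
  map_add' := map_add _
  map_smul' c ψ := (Lp.compMeasurePreservingₗ ℂ (fun x => x - 1 / lam)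
    (measurePreserving_sub_right volume (1 / lam))).map_smul c ψ
  left_inv ψ := by
    refine Lp.ext ?_
    have hq := (measurePreserving_add_right volume (1 / lam)).quasiMeasurePreserving
    filter_upwards [Lp.coeFn_compMeasurePreserving (Lp.compMeasurePreserving
        (fun x => x - 1 / lam) (measurePreserving_sub_right volume (1 / lam)) ψ)
        (measurePreserving_add_right volume (1 / lam)),
      hq.ae (Lp.coeFn_compMeasurePreserving ψ
        (measurePreserving_sub_right volume (1 / lam)))] with x h1 h2
    rw [h1]
    simp only [Function.comp_apply, h2, add_sub_cancel_right]
  right_inv ψ := by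
    refine Lp.ext ?_
    have hq := (measurePreserving_sub_right volume (1 / lam)).quasiMeasurePreserving
    filter_upwards [Lp.coeFn_compMeasurePreserving (Lp.compMeasurePreserving
        (fun x => x + 1 / lam) (measurePreserving_add_right volume (1 / lam)) ψ)
        (measurePreserving_sub_right volume (1 / lam)),
      hq.ae (Lp.coeFn_compMeasurePreserving ψ
        (measurePreserving_add_right volume (1 / lam)))] with x h1 h2
    rw [h1]
    simp only [Function.comp_apply, h2, sub_add_cancel]
  norm_map' ψ := Lp.norm_compMeasurePreserving ψ _

/-! ### The thermal Hamiltonian -/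

/-- The operator `(Π f)(x) = i (x f(x) + x² f'(x))` on Schwartz functions. -/
def piSchwartz : 𝓢(ℝ, ℂ) →L[ℂ] 𝓢(ℝ, ℂ) :=
  Complex.I • (SchwartzMap.smulLeftCLM ℂ (fun x : ℝ => (x : ℂ)) +
    (SchwartzMap.smulLeftCLM ℂ (fun x : ℝ => (x : ℂ) ^ 2)).comp (SchwartzMap.derivCLM ℂ ℂ))

theorem piSchwartz_apply (f : 𝓢(ℝ, ℂ)) (x : ℝ) :
    piSchwartz f x = Complex.I * (x * f x + (x : ℂ) ^ 2 * deriv f x) := by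
  have h1 : (fun x : ℝ => (x : ℂ)).HasTemperateGrowth := Complex.ofRealCLM.hasTemperateGrowth
  have h2 : (fun x : ℝ => (x : ℂ) ^ 2).HasTemperateGrowth := by
    have h : (fun x : ℝ => (x : ℂ) ^ 2) = (fun x : ℝ => (x : ℂ)) * fun x : ℝ => (x : ℂ) := by
      ext x
      simp [pow_two]
    rw [h]
    exact h1.mul h1
  simp [piSchwartz, SchwartzMap.smulLeftCLM_apply_apply h1,
    SchwartzMap.smulLeftCLM_apply_apply h2, mul_add]

/-- The graph of `Π` with domain the Schwartz space, inside `L²(ℝ) × L²(ℝ)`. -/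
def piGraph : Submodule ℂ (L2 × L2) :=
  ((SchwartzMap.toLpCLM ℂ (E := ℝ) ℂ 2 volume).prod
    ((SchwartzMap.toLpCLM ℂ (E := ℝ) ℂ 2 volume).comp piSchwartz)).range

/-- The function `ζ_θ(x) = x⁻¹ e^{-1/|x|} e^{i sgn(x) θ/2}`. -/
def zetaFun (θ : ℝ) (x : ℝ) : ℂ :=
  ((x⁻¹ * Real.exp (-(1 / |x|)) : ℝ) : ℂ) * Complex.exp (Complex.I * (Real.sign x * (θ / 2) : ℝ))

theorem memLp_zetaFun (θ : ℝ) : MemLp (zetaFun θ) 2 volume := by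
  have hs : Measurable Real.sign := by
    unfold Real.sign
    exact Measurable.ite measurableSet_Iio measurable_const
      (Measurable.ite measurableSet_Ioi measurable_const measurable_const)
  have hm : AEStronglyMeasurable (zetaFun θ) volume := by
    apply Measurable.aestronglyMeasurable
    unfold zetaFun
    fun_prop
  rw [memLp_two_iff_integrable_sq_norm hm]
  refine integrable_inv_one_add_sq.mono' (by fun_prop) (Eventually.of_forall fun x => ?_)
  have h1 : ‖zetaFun θ x‖ = |x|⁻¹ * Real.exp (-(1 / |x|)) := by
    rw [zetaFun, norm_mul, mul_comm Complex.I, Complex.norm_exp_ofReal_mul_I, mul_one,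
      Complex.norm_real, Real.norm_eq_abs, abs_mul, abs_inv, Real.abs_exp]
  rw [Real.norm_of_nonneg (by positivity), h1]
  rcases eq_or_ne x 0 with rfl | hx
  · simp
  · set u := |x|⁻¹ with hu
    have hupos : 0 < u := by positivity
    have hx2 : x ^ 2 = (u ^ 2)⁻¹ := by rw [hu]; simp
    rw [one_div, ← hu, hx2, mul_pow, ← Real.exp_nat_mul]
    have h2 : 1 + u ^ 2 ≤ Real.exp (2 * u) := by
      have := Real.quadratic_le_exp_of_nonneg (x := 2 * u) (by positivity)
      nlinarith
    have h3 : (1 + (u ^ 2)⁻¹)⁻¹ = u ^ 2 * (1 + u ^ 2)⁻¹ := by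
      field_simp
      ring
    rw [h3]
    refine mul_le_mul_of_nonneg_left ?_ (by positivity)
    rw [show ((2 : ℕ) : ℝ) * -u = -(2 * u) by push_cast; ring, Real.exp_neg]
    exact inv_anti₀ (by positivity) h2

/-- The function `ζ_θ` as an element of `L²(ℝ)`. -/
def zeta (θ : ℝ) : L2 := (memLp_zetaFun θ).toLp (zetaFun θ)

/-- The standard self-adjoint realization `Π₀`: it extends the closure of `Π` (on Schwartz
functions) to the domain `D₀ + ℂ ζ₀`, where `D₀` is the domain of that closure, by
`Π₀ (ψ + c ζ₀) = Π ψ + c ζ_π`. It is given through its graph. -/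
def piZero : L2 →ₗ.[ℂ] L2 :=
  (piGraph.topologicalClosure ⊔ Submodule.span ℂ {(zeta 0, zeta Real.pi)}).toLinearPMap

/-- The one-dimensional thermal Hamiltonian `H_T = λ (F S)* Π₀ (F S)`. -/
def thermalHamiltonian (lam : ℝ) : L2 →ₗ.[ℂ] L2 :=
  (lam : ℂ) • unitaryConj ((translation lam).trans fourierL2) piZero

/-! ### Convolution perturbations -/

theorem integrable_conv_sq {g : ℝ → ℂ} (hg : Integrable g) (ψ : L2) :
    Integrable (fun x => ∫ y, ‖g (x - y)‖ * ‖ψ y‖ ^ 2) ∧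
      ∀ᵐ x, Integrable fun y => ‖g (x - y)‖ * ‖ψ y‖ ^ 2 := by
  have hψ : Integrable fun y => ‖ψ y‖ ^ 2 :=
    (memLp_two_iff_integrable_sq_norm (Lp.aestronglyMeasurable ψ)).1 (Lp.memLp ψ)
  have h1 := hψ.integrable_convolution (ContinuousLinearMap.mul ℝ ℝ) hg.norm
  have h2 := hψ.ae_convolution_exists (ContinuousLinearMap.mul ℝ ℝ) hg.norm
  refine ⟨h1.congr (Eventually.of_forall fun x => ?_), ?_⟩
  · simp [convolution, mul_comm]
  · filter_upwards [h2] with x hx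
    exact Integrable.congr hx (Eventually.of_forall fun y => by simp [mul_comm])

theorem ae_integrable_conv {g : ℝ → ℂ} (hg : Integrable g) (ψ : L2) :
    ∀ᵐ x, Integrable fun y => g (x - y) * ψ y := by
  filter_upwards [(integrable_conv_sq hg ψ).2] with x hx
  have hgx := hg.comp_sub_left x
  refine (hgx.norm.add hx).mono' (hgx.aestronglyMeasurable.mul (Lp.aestronglyMeasurable ψ))
    (Eventually.of_forall fun y => ?_)
  simp only [Pi.add_apply, norm_mul]
  nlinarith [norm_nonneg (g (x - y)), norm_nonneg (ψ y), sq_nonneg (‖ψ y‖ - 1),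
    mul_nonneg (norm_nonneg (g (x - y))) (sq_nonneg (‖ψ y‖ - 1)),
    mul_nonneg (norm_nonneg (g (x - y))) (sq_nonneg (‖ψ y‖))]

theorem memLp_conv {g : ℝ → ℂ} (hg : Integrable g) (ψ : L2) :
    MemLp (fun x => ∫ y, g (x - y) * ψ y) 2 volume := by
  have hm : AEStronglyMeasurable (fun x => ∫ y, g (x - y) * ψ y) volume := by
    have := ((Lp.aestronglyMeasurable ψ).convolution_integrand (ContinuousLinearMap.mul ℝ ℂ)
      hg.aestronglyMeasurable).integral_prod_right'
    refine this.congr (Eventually.of_forall fun x => ?_)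
    simp [mul_comm]
  rw [memLp_two_iff_integrable_sq_norm hm]
  refine ((integrable_conv_sq hg ψ).1.const_mul (∫ y, ‖g y‖)).mono' (by fun_prop) ?_
  filter_upwards [(integrable_conv_sq hg ψ).2, ae_integrable_conv hg ψ] with x hx1 hx2
  rw [Real.norm_of_nonneg (by positivity)]
  have hgx := (hg.comp_sub_left x).norm
  have hG : ∫ y, ‖g (x - y)‖ = ∫ y, ‖g y‖ := integral_sub_left_eq_self (fun y => ‖g y‖) volume x
  have hA : Integrable fun y => ‖g (x - y)‖ * ‖ψ y‖ := by simpa using hx2.norm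
  have hquad : ∀ s : ℝ, 0 ≤ (∫ y, ‖g y‖) * (s * s) + (-2 * ∫ y, ‖g (x - y)‖ * ‖ψ y‖) * s +
      ∫ y, ‖g (x - y)‖ * ‖ψ y‖ ^ 2 := fun s => by
    have h0 : 0 ≤ ∫ y, ‖g (x - y)‖ * (s - ‖ψ y‖) ^ 2 :=
      integral_nonneg fun y => by positivity
    have h1 : ∫ y, ‖g (x - y)‖ * (s - ‖ψ y‖) ^ 2 =
        ∫ y, (‖g (x - y)‖ * (s * s) + (‖g (x - y)‖ * ‖ψ y‖) * (-2 * s) +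
          ‖g (x - y)‖ * ‖ψ y‖ ^ 2) := integral_congr_ae (Eventually.of_forall fun y => by
            simp only; ring)
    have h2 : Integrable fun y => ‖g (x - y)‖ * (s * s) + (‖g (x - y)‖ * ‖ψ y‖) * (-2 * s) :=
      (hgx.mul_const _).add (hA.mul_const _)
    rw [h1, integral_add h2 hx1,
      integral_add (hgx.mul_const _) (hA.mul_const _), integral_mul_const, integral_mul_const,
      hG] at h0
    linarith
  have hd := discrim_le_zero hquad
  rw [discrim] at hd
  have hn : ‖∫ y, g (x - y) * ψ y‖ ≤ ∫ y, ‖g (x - y)‖ * ‖ψ y‖ := by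
    simpa using norm_integral_le_integral_norm (fun y => g (x - y) * ψ y)
  have h0 := norm_nonneg (∫ y, g (x - y) * ψ y)
  nlinarith

/-- The convolution operator `(W_g ψ)(x) = ∫ g(x - y) ψ(y) dy` on `L²(ℝ)`, for `g ∈ L¹(ℝ)`. -/
def convOp (g : ℝ → ℂ) (hg : Integrable g) : L2 →ₗ[ℂ] L2 where
  toFun ψ := (memLp_conv hg ψ).toLp (fun x => ∫ y, g (x - y) * ψ y)
  map_add' ψ φ := by
    rw [← MemLp.toLp_add]
    refine MemLp.toLp_congr _ _ ?_
    filter_upwards [ae_integrable_conv hg ψ, ae_integrable_conv hg φ] with x h1 h2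
    rw [Pi.add_apply, ← integral_add h1 h2]
    refine integral_congr_ae ?_
    filter_upwards [Lp.coeFn_add ψ φ] with y hy
    simp only [hy, Pi.add_apply, mul_add]
  map_smul' c ψ := by
    rw [RingHom.id_apply, ← MemLp.toLp_const_smul]
    refine MemLp.toLp_congr _ _ (Eventually.of_forall fun x => ?_)
    simp only [Pi.smul_apply]
    rw [← integral_smul]
    refine integral_congr_ae ?_
    filter_upwards [Lp.coeFn_smul c ψ] with y hy
    simp only [hy, Pi.smul_apply, smul_eq_mul]
    ring

/-- The perturbed operator `H_{T,g} = H_T + W_g`, with domain `D(H_T)`. -/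
def perturbedHamiltonian (lam : ℝ) (g : ℝ → ℂ) (hg : Integrable g) : L2 →ₗ.[ℂ] L2 :=
  convOp g hg +ᵥ thermalHamiltonian lam

/-- The Fourier transform `ĝ(k) = (2π)^{-1/2} ∫ e^{-ikx} g(x) dx` of an integrable function. -/
def gHat (g : ℝ → ℂ) (k : ℝ) : ℂ :=
  ((√(2 * Real.pi))⁻¹ : ℝ) * ∫ x : ℝ, Complex.exp (-Complex.I * k * x) * g x

end

end Thermal

open Thermal

namespace Thermal

noncomputable section

/-! ### Multiplication operators on `L²(ℝ)` -/

/-! In the variable y = 1/x the singular operator Π₀ becomes the ordinary momentum operator p = -i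
d/dy. With the unitary involution (Jψ)(y) = y⁻¹ψ(1/y) and K = J F S_λ, this gives K H_T K* = λp.
Convolution commutes with translations and is diagonal in Fourier space, so K W_g K* is
multiplication by v(y) = √(2π) ĝ(1/y), which is real by the symmetry of g, bounded, and continuous
once v(0) = 0 (Riemann–Lebesgue).

In one dimension λp + v is a pure gauge: if G(y) = λ⁻¹∫₀^y v, then λp e^{iG} = e^{iG}(λp + v). Hence
`H_{T,g}` and H_T are both unitarily equivalent to multiplication by 2πλk in Mathlib's Fourier
variable (`diagonalizes_thermalHamiltonian`, `diagonalizes_perturbedHamiltonian`). Self-adjointness,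
spectrum, spectral measure and propagator are then read off from the general theory of real
multiplication operators (`Diagonalizes`).

Both evolutions are translations by λt, the perturbed one conjugated by e^{iG}. So
e^{itH_{T,g}}e^{-itH_T} is, after conjugation by K, multiplication by exp(i(G(y+λt) - G(y))). The
3/2-power bound on ĝ at 0 is an integrable decay bound on v at infinity, so G has limits G(±∞), the
wave operators are the unitaries K* e^{i(G(±∞) - G)} K, and the S-matrix is the constant e^{i(G(-∞)
- G(+∞))}. The substitution s = 1/y turns ∫v into √(2π)∫ĝ(s)/s² ds.

The delicate point is the identity Π₀ = JpJ (`piZeroGraph_eq`), since Π₀ is defined by a closure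
plus one extra vector. Inverted Schwartz functions vanish at y = 0, and Π alone misses one
dimension. The orthogonal complement of the range of Π - i is computed from a first-order
differential equation and lies in the line spanned by (JpJ - i)ζ₀ = ζ_π - iζ₀. Adding ζ₀ to the
domain thus makes the range full, and JpJ has no room for a proper restriction with that property.
-/

theorem inner_eq_integral (φ ψ : L2) : inner ℂ φ ψ = ∫ x, conj (φ x) * ψ x := by
  rw [L2.inner_def]
  refine integral_congr_ae (Eventually.of_forall fun x => ?_)
  simp [RCLike.inner_apply, mul_comm]

theorem norm_sq_eq_integral (φ : L2) : ‖φ‖ ^ 2 = ∫ x, ‖φ x‖ ^ 2 := by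
  have h := inner_eq_integral φ φ
  have h2 : inner ℂ φ φ = ((‖φ‖ ^ 2 : ℝ) : ℂ) := by
    rw [inner_self_eq_norm_sq_to_K]; norm_cast
  have h3 : ∀ x, conj (φ x) * φ x = ((‖φ x‖ ^ 2 : ℝ) : ℂ) := fun x => by
    rw [Complex.conj_mul']; norm_cast
  simp only [h2, h3] at h
  rw [integral_complex_ofReal] at h
  exact_mod_cast h

theorem integrable_conj_mul {f g : ℝ → ℂ} (hf : MemLp f 2 volume) (hg : MemLp g 2 volume) :
    Integrable fun x => conj (f x) * g x := by
  have h : MemLp (fun x => conj (f x)) 2 volume := hf.star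
  exact h.integrable_mul hg

/-- Dominated convergence in `L²(ℝ)`. -/
theorem tendsto_L2_of_dominated {ι : Type*} {l : Filter ι} [l.IsCountablyGenerated]
    {F : ι → L2} {f : L2} {Φ : ι → ℝ → ℂ} {G : ℝ → ℝ} (hG : MemLp G 2 volume)
    (hΦ : ∀ i, F i =ᵐ[volume] Φ i) (hb : ∀ᶠ i in l, ∀ᵐ x, ‖Φ i x‖ ≤ G x)
    (hlim : ∀ᵐ x, Tendsto (fun i => Φ i x) l (𝓝 (f x))) : Tendsto F l (𝓝 f) := by
  rw [tendsto_iff_norm_sub_tendsto_zero]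
  have key : ∀ i, ‖F i - f‖ ^ 2 = ∫ x, ‖Φ i x - f x‖ ^ 2 := fun i => by
    rw [norm_sq_eq_integral]
    refine integral_congr_ae ?_
    filter_upwards [hΦ i, Lp.coeFn_sub (F i) f] with x h1 h2
    rw [h2, Pi.sub_apply, h1]
  have h0 : Tendsto (fun i => ∫ x, ‖Φ i x - f x‖ ^ 2) l (𝓝 (∫ _ : ℝ, (0 : ℝ))) := by
    refine tendsto_integral_filter_of_dominated_convergence
      (fun x => (G x + ‖f x‖) ^ 2) (Eventually.of_forall fun i => ?_) ?_ ?_ ?_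
    · have : AEStronglyMeasurable (Φ i) volume :=
        (Lp.aestronglyMeasurable (F i)).congr (hΦ i)
      exact ((this.sub (Lp.aestronglyMeasurable f)).norm.pow 2)
    · filter_upwards [hb] with i hi
      filter_upwards [hi] with x hx
      rw [Real.norm_of_nonneg (by positivity)]
      refine pow_le_pow_left₀ (norm_nonneg _) ((norm_sub_le _ _).trans ?_) 2
      gcongr
    · exact (hG.add (Lp.memLp f).norm).integrable_sq
    · filter_upwards [hlim] with x hx
      have h := (hx.sub_const (f x)).norm.pow 2
      simpa using h
  rw [integral_zero] at h0
  have h1 := (h0.congr fun i => (key i).symm).sqrt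
  simpa using h1

/-- Bounded measurable functions. -/
structure BddMeas (b : ℝ → ℂ) : Prop where
  meas : Measurable b
  bdd : ∃ C : ℝ, ∀ x, ‖b x‖ ≤ C

theorem memLp_bdd_mul {b : ℝ → ℂ} (hb : BddMeas b) {f : ℝ → ℂ} (hf : MemLp f 2 volume) :
    MemLp (fun x => b x * f x) 2 volume := by
  obtain ⟨C, hC⟩ := hb.bdd
  refine MemLp.of_le_mul (c := C) hf (hb.meas.aestronglyMeasurable.mul hf.1)
    (Eventually.of_forall fun x => ?_)
  rw [norm_mul]
  exact mul_le_mul_of_nonneg_right (hC x) (norm_nonneg _)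

/-- Multiplication by a bounded measurable function, as a linear map. -/
def bmulₗ (b : ℝ → ℂ) (hb : BddMeas b) : L2 →ₗ[ℂ] L2 where
  toFun ψ := (memLp_bdd_mul hb (Lp.memLp ψ)).toLp (fun x => b x * ψ x)
  map_add' ψ φ := by
    rw [← MemLp.toLp_add]
    refine MemLp.toLp_congr _ _ ?_
    filter_upwards [Lp.coeFn_add ψ φ] with x hx
    simp only [hx, Pi.add_apply, mul_add]
  map_smul' c ψ := by
    rw [RingHom.id_apply, ← MemLp.toLp_const_smul]
    refine MemLp.toLp_congr _ _ ?_
    filter_upwards [Lp.coeFn_smul c ψ] with x hx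
    simp only [hx, Pi.smul_apply, smul_eq_mul]
    ring

theorem coeFn_bmulₗ (b : ℝ → ℂ) (hb : BddMeas b) (ψ : L2) :
    bmulₗ b hb ψ =ᵐ[volume] fun x => b x * ψ x :=
  MemLp.coeFn_toLp (memLp_bdd_mul hb (Lp.memLp ψ))

/-- Multiplication by a bounded measurable function, as a bounded operator. -/
def bmul (b : ℝ → ℂ) (hb : BddMeas b) : L2 →L[ℂ] L2 :=
  (bmulₗ b hb).mkContinuous hb.bdd.choose fun ψ => by
    refine Lp.norm_le_mul_norm_of_ae_le_mul ?_
    filter_upwards [coeFn_bmulₗ b hb ψ] with x hx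
    rw [hx, norm_mul]
    exact mul_le_mul_of_nonneg_right (hb.bdd.choose_spec x) (norm_nonneg _)

theorem coeFn_bmul {b : ℝ → ℂ} (hb : BddMeas b) (ψ : L2) :
    bmul b hb ψ =ᵐ[volume] fun x => b x * ψ x :=
  coeFn_bmulₗ b hb ψ

theorem bmul_congr {b : ℝ → ℂ} (hb : BddMeas b) {φ ψ : L2}
    (h : φ =ᵐ[volume] fun x => b x * ψ x) : φ = bmul b hb ψ :=
  Lp.ext (h.trans (coeFn_bmul hb ψ).symm)

theorem bddMeas_mul {b c : ℝ → ℂ} (hb : BddMeas b) (hc : BddMeas c) :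
    BddMeas fun x => b x * c x := by
  obtain ⟨B, hB⟩ := hb.bdd
  obtain ⟨C, hC⟩ := hc.bdd
  refine ⟨hb.meas.mul hc.meas, B * C, fun x => ?_⟩
  rw [norm_mul]
  exact mul_le_mul (hB x) (hC x) (norm_nonneg _) ((norm_nonneg _).trans (hB x))

theorem bmul_bmul {b c : ℝ → ℂ} (hb : BddMeas b) (hc : BddMeas c) (ψ : L2) :
    bmul b hb (bmul c hc ψ) = bmul _ (bddMeas_mul hb hc) ψ := by
  refine bmul_congr _ ?_
  filter_upwards [coeFn_bmul hb (bmul c hc ψ), coeFn_bmul hc ψ] with x h1 h2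
  rw [h1, h2, mul_assoc]

/-- The uniform bound makes C‖ψ‖ a dominating function. This serves twice: for the strong continuity
of the propagators and for the existence of the wave operators. -/
theorem tendsto_bmul {ι : Type*} {l : Filter ι} [l.IsCountablyGenerated] {b : ι → ℝ → ℂ}
    (hb : ∀ i, BddMeas (b i)) {b' : ℝ → ℂ} (hb' : BddMeas b') {C : ℝ}
    (hC : ∀ i x, ‖b i x‖ ≤ C) (hlim : ∀ x, Tendsto (fun i => b i x) l (𝓝 (b' x))) (ψ : L2) :
    Tendsto (fun i => bmul (b i) (hb i) ψ) l (𝓝 (bmul b' hb' ψ)) := by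
  refine tendsto_L2_of_dominated (G := fun x => C * ‖ψ x‖) ((Lp.memLp ψ).norm.const_mul C)
    (fun i => coeFn_bmul (hb i) ψ) (Eventually.of_forall fun i => Eventually.of_forall fun x => ?_)
    ?_
  · rw [norm_mul]
    exact mul_le_mul_of_nonneg_right (hC i x) (norm_nonneg _)
  · filter_upwards [coeFn_bmul hb' ψ] with x hx
    rw [hx]
    exact (hlim x).mul_const _

theorem bddMeas_exp {θ : ℝ → ℝ} (hθ : Measurable θ) :
    BddMeas fun x => Complex.exp (θ x * Complex.I) :=
  ⟨by fun_prop, 1, fun x => (Complex.norm_exp_ofReal_mul_I _).le⟩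

theorem bmul_exp_neg_exp {θ η : ℝ → ℝ} (hθ : Measurable θ) (hη : Measurable η)
    (h : ∀ x, θ x + η x = 0) (ψ : L2) :
    bmul _ (bddMeas_exp hθ) (bmul _ (bddMeas_exp hη) ψ) = ψ := by
  rw [bmul_bmul]
  refine Lp.ext ?_
  filter_upwards [coeFn_bmul (bddMeas_mul (bddMeas_exp hθ) (bddMeas_exp hη)) ψ] with x hx
  rw [hx, ← Complex.exp_add, ← add_mul, ← Complex.ofReal_add, h]
  simp

/-- Multiplication by the phase `e^{iθ}`, as a unitary operator. -/
def phase (θ : ℝ → ℝ) (hθ : Measurable θ) : L2 ≃ₗᵢ[ℂ] L2 where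
  toLinearEquiv := LinearEquiv.ofLinearMap (bmul _ (bddMeas_exp hθ) : L2 →ₗ[ℂ] L2)
    (bmul _ (bddMeas_exp hθ.neg) : L2 →ₗ[ℂ] L2)
    (LinearMap.ext fun ψ => bmul_exp_neg_exp hθ hθ.neg (by simp) ψ)
    (LinearMap.ext fun ψ => bmul_exp_neg_exp hθ.neg hθ (by simp) ψ)
  norm_map' ψ := by
    have h : ‖bmul _ (bddMeas_exp hθ) ψ‖ = ‖ψ‖ := by
      rw [Lp.norm_def, Lp.norm_def]
      refine congrArg _ (eLpNorm_congr_norm_ae ?_)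
      filter_upwards [coeFn_bmul (bddMeas_exp hθ) ψ] with x hx
      rw [hx, norm_mul, Complex.norm_exp_ofReal_mul_I, one_mul]
    exact h

theorem coeFn_phase {θ : ℝ → ℝ} (hθ : Measurable θ) (ψ : L2) :
    phase θ hθ ψ =ᵐ[volume] fun x => Complex.exp (θ x * Complex.I) * ψ x :=
  coeFn_bmul (bddMeas_exp hθ) ψ

theorem phase_symm_apply {θ : ℝ → ℝ} (hθ : Measurable θ) (ψ : L2) :
    (phase θ hθ).symm ψ = bmul _ (bddMeas_exp hθ.neg) ψ := rfl

/-! ### Operators unitarily equivalent to a real multiplication operator -/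

/-- `W A W*` is the maximal operator of multiplication by the real function `a`. -/
structure Diagonalizes (W : L2 ≃ₗᵢ[ℂ] L2) (a : ℝ → ℝ) (A : L2 →ₗ.[ℂ] L2) : Prop where
  meas : Measurable a
  graph_iff : ∀ φ χ : L2, (φ, χ) ∈ A.graph ↔ W χ =ᵐ[volume] fun k => (a k : ℂ) * W φ k

theorem bddMeas_resolvent {a : ℝ → ℝ} (ha : Measurable a) {z : ℂ} (hz : z.im ≠ 0) :
    BddMeas fun k => ((a k : ℂ) - z)⁻¹ := by
  refine ⟨by fun_prop, |z.im|⁻¹, fun x => ?_⟩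
  rw [norm_inv]
  refine inv_anti₀ (abs_pos.2 hz) ?_
  simpa using Complex.abs_im_le_norm ((a x : ℂ) - z)

theorem ofReal_sub_ne_zero {z : ℂ} (hz : z.im ≠ 0) (r : ℝ) : (r : ℂ) - z ≠ 0 := fun h => by
  have := congrArg Complex.im h
  simp at this
  exact hz this

theorem coeFn_finset_sum {ι : Type*} (s : Finset ι) (f : ι → L2) :
    (∑ i ∈ s, f i : L2) =ᵐ[volume] ∑ i ∈ s, (f i : ℝ → ℂ) := by
  classical
  induction s using Finset.induction_on with
  | empty => simpa using Lp.coeFn_zero ℂ 2 (volume : Measure ℝ)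
  | insert i s hi ih =>
    rw [Finset.sum_insert hi, Finset.sum_insert hi]
    exact (Lp.coeFn_add _ _).trans (ih.mono fun x hx => by rw [Pi.add_apply, Pi.add_apply, hx])

namespace Diagonalizes

variable {W : L2 ≃ₗᵢ[ℂ] L2} {a : ℝ → ℝ} {A : L2 →ₗ.[ℂ] L2}

/-- The resolvent `(A - z)⁻¹` at a non-real point. -/
def resolvent (hA : Diagonalizes W a A) (z : ℂ) (hz : z.im ≠ 0) : L2 →L[ℂ] L2 :=
  (W.symm.toContinuousLinearEquiv : L2 →L[ℂ] L2).comp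
    ((bmul _ (bddMeas_resolvent hA.meas hz)).comp (W.toContinuousLinearEquiv : L2 →L[ℂ] L2))

theorem resolvent_apply (hA : Diagonalizes W a A) {z : ℂ} (hz : z.im ≠ 0) (u : L2) :
    hA.resolvent z hz u = W.symm (bmul _ (bddMeas_resolvent hA.meas hz) (W u)) := rfl

/-- Since `a` is real, `a - z` never vanishes and the equation can be solved pointwise in k. The
graph form contains injectivity, surjectivity and the domain statement at once. -/
theorem resolvent_iff (hA : Diagonalizes W a A) {z : ℂ} (hz : z.im ≠ 0) (φ u : L2) :
    (φ, u + z • φ) ∈ A.graph ↔ φ = hA.resolvent z hz u := by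
  rw [hA.graph_iff, hA.resolvent_apply, ← W.toLinearEquiv.toEquiv.apply_eq_iff_eq]
  change _ ↔ W φ = W (W.symm _)
  rw [W.apply_symm_apply]
  have hs : W (u + z • φ) =ᵐ[volume] fun k => W u k + z * W φ k := by
    rw [map_add, map_smul]
    filter_upwards [Lp.coeFn_add (W u) (z • W φ), Lp.coeFn_smul z (W φ)] with k h1 h2
    rw [h1, Pi.add_apply, h2, Pi.smul_apply, smul_eq_mul]
  constructor
  · intro h
    refine bmul_congr _ ?_
    filter_upwards [h, hs] with k h1 h2
    rw [h1] at h2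
    rw [eq_comm, inv_mul_eq_iff_eq_mul₀ (ofReal_sub_ne_zero hz _)]
    linear_combination -h2
  · intro h
    filter_upwards [hs, coeFn_bmul (bddMeas_resolvent hA.meas hz) (W u)] with k h1 h2
    rw [← h, eq_comm, inv_mul_eq_iff_eq_mul₀ (ofReal_sub_ne_zero hz _)] at h2
    rw [h1, h2]
    ring

theorem inner_eq (hA : Diagonalizes W a A) {φ₁ χ₁ φ₂ χ₂ : L2} (h₁ : (φ₁, χ₁) ∈ A.graph)
    (h₂ : (φ₂, χ₂) ∈ A.graph) : inner ℂ χ₁ φ₂ = inner ℂ φ₁ χ₂ := by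
  rw [hA.graph_iff] at h₁ h₂
  rw [← W.inner_map_map, ← W.inner_map_map φ₁, inner_eq_integral, inner_eq_integral]
  refine integral_congr_ae ?_
  filter_upwards [h₁, h₂] with k h1 h2
  rw [h1, h2, map_mul, Complex.conj_ofReal]
  ring

theorem I_im_ne : Complex.I.im ≠ 0 := by simp

theorem neg_I_im_ne : (-Complex.I).im ≠ 0 := by simp

/-- If ψ is orthogonal to the domain, take φ in the domain with Aφ = ψ + iφ. Because ψ ⊥ φ, the
symmetry of A at φ reads -i‖φ‖² = i‖φ‖², so φ = 0 and therefore ψ = 0. -/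
theorem dense_domain (hA : Diagonalizes W a A) : Dense (A.domain : Set L2) := by
  rw [Submodule.dense_iff_topologicalClosure_eq_top, Submodule.topologicalClosure_eq_top_iff,
    Submodule.eq_bot_iff]
  intro ψ hψ
  have hφ := (hA.resolvent_iff I_im_ne _ ψ).2 rfl
  set φ := hA.resolvent _ I_im_ne ψ
  have h1 : inner ℂ φ ψ = 0 :=
    (Submodule.mem_orthogonal _ _).1 hψ φ (LinearPMap.mem_domain_of_mem_graph hφ)
  have h2 := hA.inner_eq hφ hφ
  have h3 : inner ℂ ψ φ = 0 := by rw [← inner_conj_symm, h1, map_zero]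
  rw [inner_add_left, inner_add_right, h1, h3, inner_smul_left, inner_smul_right,
    Complex.conj_I] at h2
  have h4 : inner ℂ φ φ = 0 := by
    have : Complex.I * inner ℂ φ φ = 0 := by linear_combination (-1 / 2 : ℂ) * h2
    simpa using this
  rw [inner_self_eq_zero] at h4
  rw [h4, smul_zero, add_zero] at hφ
  exact A.graph_fst_eq_zero_snd hφ rfl

/-- The basic criterion: a densely defined symmetric operator for which A + i and A - i are both
onto is self-adjoint. -/
theorem isSelfAdjoint (hA : Diagonalizes W a A) : IsSelfAdjoint A := by
  rw [LinearPMap.isSelfAdjoint_def]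
  refine LinearPMap.eq_of_eq_graph (le_antisymm ?_ ?_)
  · rintro ⟨y, w⟩ hyw
    obtain ⟨y', rfl, rfl⟩ := (LinearPMap.mem_graph_iff _).1 hyw
    have hf := A.adjoint_isFormalAdjoint hA.dense_domain
    have hφ := (hA.resolvent_iff I_im_ne _ (A.adjoint y' - Complex.I • (y' : L2))).2 rfl
    set φ := hA.resolvent _ I_im_ne (A.adjoint y' - Complex.I • (y' : L2))
    -- Here φ solves (A - i)φ = (A* - i)y', so d is orthogonal to the range of A + i. That range
    -- contains d itself, whence d = 0.
    set d : L2 := y' - φ with hd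
    have key : ∀ x χ : L2, (x, χ) ∈ A.graph → inner ℂ d (χ + Complex.I • x) = 0 := by
      intro x χ hx
      have h1 := hA.inner_eq hφ hx
      obtain ⟨x', rfl, rfl⟩ := (LinearPMap.mem_graph_iff _).1 hx
      have h2' : inner ℂ (A.adjoint y') (x' : L2) = inner ℂ (y' : L2) (A x') := hf y' x'
      rw [inner_add_left, inner_sub_left, inner_smul_left, inner_smul_left, Complex.conj_I] at h1
      rw [hd, inner_sub_left, inner_add_right, inner_add_right, inner_smul_right, inner_smul_right]
      linear_combination h1 - h2'
    have h := (hA.resolvent_iff neg_I_im_ne _ d).2 rfl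
    have h0 := key _ _ h
    rw [neg_smul, neg_add_cancel_right, inner_self_eq_zero] at h0
    have h3 : (y' : L2) = φ := sub_eq_zero.1 h0
    rw [← h3, sub_add_cancel] at hφ
    exact hφ
  · rintro ⟨y, w⟩ hyw
    have h : ∀ x : A.domain, inner ℂ w (x : L2) = inner ℂ y (A x) := fun x =>
      hA.inner_eq hyw (A.mem_graph x)
    have hy := A.mem_adjoint_domain_of_exists y ⟨w, h⟩
    have := LinearPMap.adjoint_apply_eq hA.dense_domain (⟨y, hy⟩ : A.adjoint.domain) h
    exact (LinearPMap.mem_graph_iff _).2 ⟨⟨y, hy⟩, rfl, this⟩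

/-- Non-real points have a bounded multiplier as resolvent. At a real r, indicators of sets on which
`a` is close to r are approximate eigenvectors and exclude a bounded inverse. -/
theorem opSpectrum_eq (hA : Diagonalizes W a A)
    (hess : ∀ r δ : ℝ, 0 < δ → ∃ S : Set ℝ, MeasurableSet S ∧ volume S ≠ 0 ∧ volume S ≠ ∞ ∧
      ∀ k ∈ S, |a k - r| ≤ δ) :
    opSpectrum A = Set.range ((↑) : ℝ → ℂ) := by
  ext z
  constructor
  · intro h
    by_contra hz
    refine h ⟨hA.resolvent z ?_, fun φ ψ => hA.resolvent_iff _ φ ψ⟩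
    intro h0
    exact hz ⟨z.re, Complex.ext (by simp) (by simp [h0])⟩
  · rintro ⟨r, rfl⟩ ⟨R, hR⟩
    -- The tolerance δ = (‖R‖ + 1)⁻¹ satisfies ‖R‖δ < 1, which contradicts ‖f‖ ≤ ‖R‖δ‖f‖ for the
    -- indicator f of S.
    obtain ⟨S, hS, h0, hfin, hSa⟩ := hess r (‖R‖ + 1)⁻¹ (by positivity)
    have hb : BddMeas fun k => S.indicator (fun k => ((a k - r : ℝ) : ℂ)) k := by
      refine ⟨((Complex.measurable_ofReal.comp (hA.meas.sub_const r)).indicator hS),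
        (‖R‖ + 1)⁻¹, fun k => ?_⟩
      by_cases hk : k ∈ S
      · simp only [Set.indicator_of_mem hk, Complex.norm_real, Real.norm_eq_abs]
        exact hSa k hk
      · simp only [Set.indicator_of_notMem hk, norm_zero]
        positivity
    set f : L2 := indicatorConstLp 2 hS hfin (1 : ℂ)
    have hf : f =ᵐ[volume] S.indicator fun _ => (1 : ℂ) := indicatorConstLp_coeFn
    have hfpos : 0 < ‖f‖ := by
      rw [norm_pos_iff]
      intro hf0
      have : f =ᵐ[volume] 0 := by rw [hf0]; exact Lp.coeFn_zero _ _ _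
      have h1 := hf.symm.trans this
      apply h0
      refine measure_mono_null (fun k hk => ?_) h1
      simp [hk]
    set u : L2 := bmul _ hb f
    have hu : ‖u‖ ≤ (‖R‖ + 1)⁻¹ * ‖f‖ := by
      refine Lp.norm_le_mul_norm_of_ae_le_mul ?_
      filter_upwards [coeFn_bmul hb f] with k h
      rw [h, norm_mul]
      refine mul_le_mul_of_nonneg_right ?_ (norm_nonneg _)
      by_cases hk : k ∈ S
      · simp only [Set.indicator_of_mem hk, Complex.norm_real, Real.norm_eq_abs]
        exact hSa k hk
      · simp only [Set.indicator_of_notMem hk, norm_zero]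
        positivity
    have hmem : (W.symm f, W.symm u + (r : ℂ) • W.symm f) ∈ A.graph := by
      rw [hA.graph_iff, map_add, map_smul, W.apply_symm_apply, W.apply_symm_apply]
      filter_upwards [Lp.coeFn_add u ((r : ℂ) • f), Lp.coeFn_smul (r : ℂ) f, coeFn_bmul hb f, hf]
        with k h1 h2 h3 h4
      rw [h1, Pi.add_apply, h2, Pi.smul_apply, h3, h4, smul_eq_mul]
      by_cases hk : k ∈ S
      · simp [hk]
      · simp [hk]
    have h1 := (hR _ _).1 hmem
    have h2 : ‖f‖ ≤ ‖R‖ * ((‖R‖ + 1)⁻¹ * ‖f‖) := by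
      calc ‖f‖ = ‖W.symm f‖ := (W.symm.norm_map f).symm
        _ = ‖R (W.symm u)‖ := by rw [← h1]
        _ ≤ ‖R‖ * ‖W.symm u‖ := R.le_opNorm _
        _ = ‖R‖ * ‖u‖ := by rw [W.symm.norm_map]
        _ ≤ _ := by gcongr
    have h3 : ‖R‖ * ((‖R‖ + 1)⁻¹ * ‖f‖) < ‖f‖ := by
      rw [← mul_assoc]
      refine mul_lt_of_lt_one_left hfpos ?_
      rw [← div_eq_mul_inv, div_lt_one (by positivity)]
      linarith
    exact absurd h2 (not_le.2 h3)

/-! #### The spectral measure -/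

theorem bddMeas_indicator {B : Set ℝ} (hB : MeasurableSet B) :
    BddMeas (B.indicator fun _ => (1 : ℂ)) :=
  ⟨measurable_const.indicator hB, 1, fun x => by
    by_cases hx : x ∈ B <;> simp [hx]⟩

open Classical in
/-- The function `k ↦ 1_B (a k)`, or `0` if `B` is not measurable. -/
def specIndicator (a : ℝ → ℝ) (B : Set ℝ) : ℝ → ℂ :=
  if MeasurableSet B then (a ⁻¹' B).indicator fun _ => 1 else 0

theorem specIndicator_of_measurable (a : ℝ → ℝ) {B : Set ℝ} (hB : MeasurableSet B) :
    specIndicator a B = (a ⁻¹' B).indicator fun _ => 1 := if_pos hB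

theorem bddMeas_specIndicator (ha : Measurable a) (B : Set ℝ) : BddMeas (specIndicator a B) := by
  by_cases hB : MeasurableSet B
  · rw [specIndicator_of_measurable a hB]
    exact bddMeas_indicator (ha hB)
  · rw [specIndicator, if_neg hB]
    exact ⟨measurable_const, 0, fun x => by simp⟩

/-- The spectral projection of `A` on `B`. -/
def specProj (hA : Diagonalizes W a A) (B : Set ℝ) : L2 →L[ℂ] L2 :=
  (W.symm.toContinuousLinearEquiv : L2 →L[ℂ] L2).comp
    ((bmul _ (bddMeas_specIndicator hA.meas B)).comp (W.toContinuousLinearEquiv : L2 →L[ℂ] L2))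

theorem specProj_apply (hA : Diagonalizes W a A) (B : Set ℝ) (ψ : L2) :
    hA.specProj B ψ = W.symm (bmul _ (bddMeas_specIndicator hA.meas B) (W ψ)) := rfl

theorem map_specProj (hA : Diagonalizes W a A) {B : Set ℝ} (hB : MeasurableSet B) (ψ : L2) :
    W (hA.specProj B ψ) =ᵐ[volume] (a ⁻¹' B).indicator (W ψ) := by
  rw [hA.specProj_apply, W.apply_symm_apply]
  filter_upwards [coeFn_bmul (bddMeas_specIndicator hA.meas B) (W ψ)] with k hk
  rw [hk, specIndicator_of_measurable a hB]
  by_cases h : k ∈ a ⁻¹' B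
  · simp only [Set.indicator_of_mem h, one_mul]
  · simp only [Set.indicator_of_notMem h, zero_mul]

/-- The spectral measure of `A`. -/
def pvm (hA : Diagonalizes W a A) : PVM L2 where
  proj := hA.specProj
  isSelfAdjoint B hB := by
    rw [ContinuousLinearMap.isSelfAdjoint_iff_isSymmetric]
    intro φ ψ
    change inner ℂ (hA.specProj B φ) ψ = inner ℂ φ (hA.specProj B ψ)
    rw [← W.inner_map_map, ← W.inner_map_map φ, inner_eq_integral, inner_eq_integral]
    refine integral_congr_ae ?_
    filter_upwards [hA.map_specProj hB φ, hA.map_specProj hB ψ] with k h1 h2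
    rw [h1, h2]
    by_cases h : k ∈ a ⁻¹' B
    · simp only [Set.indicator_of_mem h]
    · simp only [Set.indicator_of_notMem h, mul_zero, map_zero, zero_mul]
  inter B C hB hC := by
    ext1 ψ
    change hA.specProj _ ψ = hA.specProj B (hA.specProj C ψ)
    apply W.injective
    refine Lp.ext ?_
    filter_upwards [hA.map_specProj (hB.inter hC) ψ, hA.map_specProj hB (hA.specProj C ψ),
      hA.map_specProj hC ψ] with k h1 h2 h3
    rw [h1, h2]
    by_cases h : k ∈ a ⁻¹' B
    · rw [Set.indicator_of_mem h, h3]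
      by_cases h' : k ∈ a ⁻¹' C
      · rw [Set.indicator_of_mem h', Set.indicator_of_mem (show k ∈ a ⁻¹' (B ∩ C) from ⟨h, h'⟩)]
      · rw [Set.indicator_of_notMem h', Set.indicator_of_notMem fun hh => h' hh.2]
    · rw [Set.indicator_of_notMem h, Set.indicator_of_notMem fun hh => h hh.1]
  univ := by
    ext1 ψ
    apply W.injective
    refine Lp.ext ?_
    filter_upwards [hA.map_specProj MeasurableSet.univ ψ] with k h1
    rw [h1]
    simp
  iUnion f hf hd ψ := by
    have hlim : Tendsto (fun s : Finset ℕ => W (∑ n ∈ s, hA.specProj (f n) ψ)) atTop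
        (𝓝 (W (hA.specProj (⋃ n, f n) ψ))) := by
      -- By disjointness a finite sum of projections is the indicator of a finite union; it is
      -- dominated by |Wψ| and eventually constant at each k.
      refine tendsto_L2_of_dominated (G := fun k => ‖W ψ k‖)
        (Φ := fun s => (a ⁻¹' ⋃ n ∈ s, f n).indicator (W ψ)) (Lp.memLp _).norm ?_ ?_ ?_
      · intro s
        have h1 : ∀ᵐ k, ∀ n, W (hA.specProj (f n) ψ) k = (a ⁻¹' f n).indicator (W ψ) k :=
          ae_all_iff.2 fun n => hA.map_specProj (hf n) ψ
        rw [map_sum]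
        filter_upwards [h1, coeFn_finset_sum s fun n => W (hA.specProj (f n) ψ)] with k h1 h2
        rw [h2, Finset.sum_apply, Finset.sum_congr rfl fun n _ => h1 n, Set.preimage_iUnion₂,
          Finset.indicator_biUnion_apply]
        intro i _ j _ hij
        exact (hd hij).preimage a
      · exact Eventually.of_forall fun s => Eventually.of_forall fun k =>
          norm_indicator_le_norm_self _ _
      · filter_upwards [hA.map_specProj (MeasurableSet.iUnion hf) ψ] with k hk
        rw [hk]
        by_cases h : k ∈ a ⁻¹' ⋃ n, f n
        · obtain ⟨n, hn⟩ := Set.mem_iUnion.1 h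
          refine tendsto_const_nhds.congr' ?_
          filter_upwards [eventually_ge_atTop {n}] with s hs
          rw [Set.indicator_of_mem h, Set.indicator_of_mem]
          exact Set.mem_biUnion (hs (Finset.mem_singleton_self n)) hn
        · refine tendsto_const_nhds.congr fun s => ?_
          rw [Set.indicator_of_notMem h, Set.indicator_of_notMem]
          intro h'
          obtain ⟨n, _, hn⟩ := Set.mem_iUnion₂.1 h'
          exact h (Set.mem_iUnion.2 ⟨n, hn⟩)
    have := (W.symm.continuous.tendsto _).comp hlim
    simp only [Function.comp_def, W.symm_apply_apply] at this
    exact this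

/-- All questions about the spectral measure (domain, expectation, absolute continuity) become
questions about the density |Wψ|² and its push-forward under `a`. -/
theorem measure_pvm (hA : Diagonalizes W a A) (ψ : L2) :
    hA.pvm.measure ψ =
      (volume.withDensity fun k => ENNReal.ofReal (‖W ψ k‖ ^ 2)).map a := by
  ext B hB
  rw [hA.pvm.measure_apply ψ hB, Measure.map_apply hA.meas hB,
    withDensity_apply _ (hA.meas hB), ← lintegral_indicator (hA.meas hB)]
  change ENNReal.ofReal (‖hA.specProj B ψ‖ ^ 2) = _
  have hint : Integrable fun k => ‖W (hA.specProj B ψ) k‖ ^ 2 :=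
    (memLp_two_iff_integrable_sq_norm (Lp.aestronglyMeasurable _)).1 (Lp.memLp _)
  rw [← W.norm_map, norm_sq_eq_integral,
    ofReal_integral_eq_lintegral_ofReal hint (Eventually.of_forall fun _ => sq_nonneg _)]
  refine lintegral_congr_ae ?_
  filter_upwards [hA.map_specProj hB ψ] with k hk
  rw [hk]
  by_cases h : k ∈ a ⁻¹' B
  · simp only [Set.indicator_of_mem h]
  · simp only [Set.indicator_of_notMem h]
    simp

theorem mem_domain_iff (hA : Diagonalizes W a A) (ψ : L2) :
    ψ ∈ A.domain ↔ MemLp (fun k => (a k : ℂ) * W ψ k) 2 volume := by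
  rw [LinearPMap.mem_domain_iff]
  constructor
  · rintro ⟨χ, hχ⟩
    exact (memLp_congr_ae ((hA.graph_iff _ _).1 hχ)).1 (Lp.memLp _)
  · intro h
    refine ⟨W.symm (h.toLp _), (hA.graph_iff _ _).2 ?_⟩
    rw [W.apply_symm_apply]
    exact h.coeFn_toLp

theorem isSpectralMeasure (hA : Diagonalizes W a A) : hA.pvm.IsSpectralMeasure A := by
  have hm : ∀ ψ : L2, AEMeasurable (fun k => ENNReal.ofReal (‖W ψ k‖ ^ 2)) volume := fun ψ =>
    ((Lp.aestronglyMeasurable (W ψ)).norm.pow 2).aemeasurable.ennreal_ofReal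
  refine ⟨fun ψ => ?_, fun ψ => ?_⟩
  · have haes : AEStronglyMeasurable (fun k => (a k : ℂ) * W ψ k) volume :=
      (Complex.measurable_ofReal.comp hA.meas).aestronglyMeasurable.mul
        (Lp.aestronglyMeasurable _)
    rw [hA.mem_domain_iff, memLp_two_iff_integrable_sq_norm haes, hA.measure_pvm,
      lintegral_map (by fun_prop) hA.meas, lintegral_withDensity_eq_lintegral_mul₀ (hm ψ)
        (hA.meas.pow_const 2).ennreal_ofReal.aemeasurable,
      Integrable, and_iff_right (by exact haes.norm.pow 2), hasFiniteIntegral_iff_ofReal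
        (Eventually.of_forall fun _ => sq_nonneg _)]
    refine Eq.to_iff (congrArg (· < ∞) (lintegral_congr fun k => ?_))
    rw [Pi.mul_apply, ← ENNReal.ofReal_mul (sq_nonneg _), norm_mul, mul_pow, Complex.norm_real,
      Real.norm_eq_abs, sq_abs, mul_comm]
  · have h := (hA.graph_iff _ _).1 (A.mem_graph ψ)
    rw [hA.measure_pvm, integral_map hA.meas.aemeasurable (by fun_prop),
      integral_withDensity_eq_integral_toReal_smul₀ (hm _)
        (Eventually.of_forall fun _ => ENNReal.ofReal_lt_top), ← W.inner_map_map,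
      inner_eq_integral, ← integral_complex_ofReal]
    refine integral_congr_ae ?_
    filter_upwards [h] with k hk
    rw [hk, ENNReal.toReal_ofReal (sq_nonneg _), smul_eq_mul]
    push_cast
    rw [← Complex.conj_mul']
    ring

/-- A push-forward of an absolutely continuous measure stays absolutely continuous when preimages of
null sets under `a` are null. -/
theorem acSubspace_eq_top (hA : Diagonalizes W a A)
    (ha : Measure.QuasiMeasurePreserving a volume volume) : hA.pvm.acSubspace = ⊤ := by
  rw [eq_top_iff]
  intro ψ _
  change hA.pvm.measure ψ ≪ volume
  rw [hA.measure_pvm]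
  exact ((withDensity_absolutelyContinuous _ _).map hA.meas).trans ha.absolutelyContinuous

/-! #### The propagator -/

/-- The unitary group `t ↦ e^{-itA}`. -/
def propagator (hA : Diagonalizes W a A) (t : ℝ) : L2 ≃ₗᵢ[ℂ] L2 :=
  (W.trans (phase (fun k => -t * a k) (hA.meas.const_mul _))).trans W.symm

theorem map_propagator (hA : Diagonalizes W a A) (t : ℝ) (ψ : L2) :
    W (hA.propagator t ψ) =ᵐ[volume]
      fun k => Complex.exp ((-t * a k : ℝ) * Complex.I) * W ψ k := by
  change W (W.symm _) =ᵐ[volume] _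
  rw [W.apply_symm_apply]
  exact coeFn_phase (hA.meas.const_mul (-t)) (W ψ)

theorem propagator_zero (hA : Diagonalizes W a A) (ψ : L2) : hA.propagator 0 ψ = ψ := by
  apply W.injective
  refine Lp.ext ?_
  filter_upwards [hA.map_propagator 0 ψ] with k h
  rw [h]
  simp

theorem hasDerivAt_propagator (hA : Diagonalizes W a A) {ψ φ : L2} (h : (ψ, φ) ∈ A.graph) :
    HasDerivAt (fun t => hA.propagator t ψ) (-Complex.I • φ) 0 := by
  rw [hasDerivAt_iff_tendsto_slope]
  have hlim : Tendsto (fun t => W (slope (fun t => hA.propagator t ψ) 0 t)) (𝓝[≠] 0)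
      (𝓝 (W (-Complex.I • φ))) := by
    refine tendsto_L2_of_dominated (G := fun k => ‖W φ k‖) (Lp.memLp _).norm
      (Φ := fun t k => slope (fun t : ℝ => Complex.exp ((-t * a k : ℝ) * Complex.I)) 0 t * W ψ k)
      ?_ ?_ ?_
    · intro t
      have hs : ∀ x : L2, W ((t - 0)⁻¹ • x) = (t - 0)⁻¹ • W x := fun x =>
        W.toLinearEquiv.toLinearMap.map_smul_of_tower _ _
      rw [slope_def_module, hs, map_sub, hA.propagator_zero]
      filter_upwards [Lp.coeFn_smul (t - 0)⁻¹ (W (hA.propagator t ψ) - W ψ),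
        Lp.coeFn_sub (W (hA.propagator t ψ)) (W ψ), hA.map_propagator t ψ] with k h1 h2 h3
      rw [h1, Pi.smul_apply, h2, Pi.sub_apply, h3, slope_def_module]
      simp only [neg_zero, zero_mul, Complex.ofReal_zero, Complex.exp_zero, Complex.real_smul]
      ring
    · refine Eventually.of_forall fun t => ?_
      filter_upwards [(hA.graph_iff _ _).1 h] with k hk
      rw [norm_mul, hk, norm_mul]
      refine mul_le_mul_of_nonneg_right ?_ (norm_nonneg _)
      rw [slope_def_module, norm_smul, sub_zero, norm_inv]
      -- The bound |e^{is} - 1| ≤ |s| dominates the difference quotients by |a Wψ| = |Wφ|, which is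
      -- square integrable precisely because ψ lies in the domain.
      have h1 : ‖Complex.exp ((-t * a k : ℝ) * Complex.I) - 1‖ ≤ ‖-t * a k‖ := by
        rw [mul_comm]
        exact Real.norm_exp_I_mul_ofReal_sub_one_le
      simp only [neg_zero, zero_mul, Complex.ofReal_zero, Complex.exp_zero]
      rcases eq_or_ne t 0 with rfl | ht
      · simp
      · rw [inv_mul_le_iff₀ (norm_pos_iff.2 ht)]
        refine h1.trans_eq ?_
        rw [norm_mul, norm_neg, Complex.norm_real]
    · rw [map_smul]
      filter_upwards [(hA.graph_iff _ _).1 h, Lp.coeFn_smul (-Complex.I) (W φ)] with k hk h1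
      rw [h1, Pi.smul_apply, hk, smul_eq_mul]
      have hd : HasDerivAt (fun t : ℝ => Complex.exp ((-t * a k : ℝ) * Complex.I))
          (-a k * Complex.I) 0 := by
        have h2 : HasDerivAt (fun t : ℝ => -t * a k) (-1 * a k) 0 :=
          (hasDerivAt_id (0 : ℝ)).neg.mul_const (a k)
        have h3 := (h2.ofReal_comp.mul_const Complex.I).cexp
        convert h3 using 1
        simp
      have h4 := (hasDerivAt_iff_tendsto_slope.1 hd).mul_const (W ψ k)
      convert h4 using 2
      ring
  have := (W.symm.continuous.tendsto _).comp hlim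
  simpa only [Function.comp_def, W.symm_apply_apply] using this

theorem isPropagator (hA : Diagonalizes W a A) : IsPropagator A hA.propagator := by
  refine ⟨fun s t ψ => ?_, fun ψ => ?_, fun ψ φ => ⟨hA.hasDerivAt_propagator, fun hd => ?_⟩⟩
  · apply W.injective
    refine Lp.ext ?_
    filter_upwards [hA.map_propagator (s + t) ψ, hA.map_propagator s (hA.propagator t ψ),
      hA.map_propagator t ψ] with k h1 h2 h3
    rw [h1, h2, h3, ← mul_assoc, ← Complex.exp_add]
    congr 2
    push_cast
    ring
  · refine W.symm.continuous.comp (continuous_iff_continuousAt.2 fun t => ?_)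
    refine tendsto_bmul (C := 1) (fun s => bddMeas_exp (hA.meas.const_mul (-s)))
      (bddMeas_exp (hA.meas.const_mul (-t))) (fun s k => (Complex.norm_exp_ofReal_mul_I _).le)
      (fun k => ?_) (W ψ)
    exact Continuous.tendsto (by fun_prop) t
  -- For the converse, ψ is only known to have a differentiable orbit. The resolvent R at i commutes
  -- with the group and sends ψ into the domain; differentiating the orbit of Rψ in two ways gives
  -- R(φ - iψ) = ψ, hence ψ is in the domain and Aψ = φ.
  · set R := hA.resolvent _ I_im_ne with hRdef
    have hcomm : ∀ t, R (hA.propagator t ψ) = hA.propagator t (R ψ) := by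
      intro t
      apply W.injective
      rw [hRdef, hA.resolvent_apply, hA.resolvent_apply, W.apply_symm_apply]
      refine Lp.ext ?_
      filter_upwards [hA.map_propagator t ψ, coeFn_bmul (bddMeas_resolvent hA.meas I_im_ne)
        (W (hA.propagator t ψ)), hA.map_propagator t
          (W.symm (bmul _ (bddMeas_resolvent hA.meas I_im_ne) (W ψ))),
        coeFn_bmul (bddMeas_resolvent hA.meas I_im_ne) (W ψ)] with k h1 h2 h3 h4
      rw [h2, h1, h3, W.apply_symm_apply, h4]
      ring
    have h1 : HasDerivAt (fun t => hA.propagator t (R ψ)) (R (-Complex.I • φ)) 0 := by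
      have := (R.restrictScalars ℝ).hasFDerivAt.comp_hasDerivAt_of_eq (0 : ℝ) hd rfl
      exact this.congr_of_eventuallyEq (Eventually.of_forall fun t => (hcomm t).symm)
    have h2 := hA.hasDerivAt_propagator ((hA.resolvent_iff I_im_ne _ ψ).2 rfl)
    have h3 := h1.unique h2
    rw [map_smul] at h3
    have h4 : R φ = ψ + Complex.I • R ψ := smul_right_injective _ (neg_ne_zero.2 Complex.I_ne_zero) h3
    have h5 : R (φ - Complex.I • ψ) = ψ := by
      rw [map_sub, map_smul, h4]; abel
    have h6 := (hA.resolvent_iff I_im_ne ψ (φ - Complex.I • ψ)).2 h5.symm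
    rwa [sub_add_cancel] at h6

end Diagonalizes

/-- The absolutely continuous subspace equals `⊤` only propositionally and is a different type from
H, so bounded inverses have to be carried across the inclusion in both directions. -/
theorem opSpectrum_part_of_eq_top {H : Type*} [NormedAddCommGroup H] [InnerProductSpace ℂ H]
    (A : H →ₗ.[ℂ] H) {K : Submodule ℂ H} (hK : K = ⊤) : opSpectrum (part A K) = opSpectrum A := by
  subst hK
  have hg : ∀ φ ψ : (⊤ : Submodule ℂ H),
      (φ, ψ) ∈ (part A ⊤).graph ↔ ((φ : H), (ψ : H)) ∈ A.graph := by
    intro φ ψ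
    rw [part, Submodule.toLinearPMap_graph_eq]
    · rfl
    · rintro ⟨x, y⟩ hxy hx
      have h : ((x : H), (y : H)) ∈ A.graph := hxy
      have hx' : x = 0 := hx
      exact Subtype.ext (A.graph_fst_eq_zero_snd h (by rw [hx']; rfl))
  have he : opResolventSet (part A ⊤) = opResolventSet A := by
    ext z
    constructor
    · rintro ⟨R, hR⟩
      refine ⟨(Submodule.subtypeL ⊤).comp (R.comp
        (ContinuousLinearMap.codRestrict (.id ℂ H) ⊤ fun _ => trivial)), fun φ ψ => ?_⟩
      have h := hR ⟨φ, trivial⟩ ⟨ψ, trivial⟩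
      rw [hg] at h
      exact h.trans Subtype.ext_iff
    · rintro ⟨R, hR⟩
      refine ⟨ContinuousLinearMap.codRestrict (R.comp (Submodule.subtypeL ⊤)) ⊤
        fun _ => trivial, fun φ ψ => ?_⟩
      rw [hg]
      exact (hR φ ψ).trans ⟨fun h => Subtype.ext h, fun h => congrArg Subtype.val h⟩
  rw [opSpectrum, opSpectrum, he]

/-! ### The momentum operator `-i d/dy` -/

open FourierTransform in
theorem fourier_toLp (f : 𝓢(ℝ, ℂ)) :
    Lp.fourierTransformₗᵢ ℝ ℂ (f.toLp 2 volume) = (𝓕 f).toLp 2 volume :=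
  SchwartzMap.toLp_fourier_eq f

theorem measurable_two_pi_mul : Measurable fun k : ℝ => 2 * Real.pi * k :=
  measurable_const_mul _

/-- The graph of `-i d/dy`, defined through the Fourier transform. -/
def momentumGraph : Submodule ℂ (L2 × L2) where
  carrier := {p | Lp.fourierTransformₗᵢ ℝ ℂ p.2 =ᵐ[volume]
    fun k => ((2 * Real.pi * k : ℝ) : ℂ) * Lp.fourierTransformₗᵢ ℝ ℂ p.1 k}
  zero_mem' := by
    simp only [Set.mem_ofPred_eq, Prod.snd_zero, Prod.fst_zero, map_zero]
    exact Eventually.of_forall fun k => by simp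
  add_mem' {p q} hp hq := by
    simp only [Set.mem_ofPred_eq, Prod.snd_add, Prod.fst_add, map_add] at hp hq ⊢
    filter_upwards [hp, hq, Lp.coeFn_add (Lp.fourierTransformₗᵢ ℝ ℂ p.1)
      (Lp.fourierTransformₗᵢ ℝ ℂ q.1), Lp.coeFn_add (Lp.fourierTransformₗᵢ ℝ ℂ p.2)
      (Lp.fourierTransformₗᵢ ℝ ℂ q.2)] with k h1 h2 h3 h4
    rw [h3, h4, Pi.add_apply, Pi.add_apply, h1, h2, mul_add]
  smul_mem' c p hp := by
    simp only [Set.mem_ofPred_eq, Prod.smul_snd, Prod.smul_fst, map_smul] at hp ⊢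
    filter_upwards [hp, Lp.coeFn_smul c (Lp.fourierTransformₗᵢ ℝ ℂ p.1),
      Lp.coeFn_smul c (Lp.fourierTransformₗᵢ ℝ ℂ p.2)] with k h1 h2 h3
    rw [h2, h3, Pi.smul_apply, Pi.smul_apply, h1, smul_eq_mul, smul_eq_mul]
    ring

theorem mem_momentumGraph {φ χ : L2} : (φ, χ) ∈ momentumGraph ↔
    Lp.fourierTransformₗᵢ ℝ ℂ χ =ᵐ[volume]
      fun k => ((2 * Real.pi * k : ℝ) : ℂ) * Lp.fourierTransformₗᵢ ℝ ℂ φ k :=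
  Iff.rfl

/-- The self-adjoint momentum operator `-i d/dy`. -/
def momentum : L2 →ₗ.[ℂ] L2 := momentumGraph.toLinearPMap

theorem momentum_graph : momentum.graph = momentumGraph := by
  refine Submodule.toLinearPMap_graph_eq _ ?_
  rintro ⟨φ, χ⟩ h h0
  have h0' : φ = 0 := h0
  subst h0'
  rw [mem_momentumGraph, map_zero] at h
  apply (Lp.fourierTransformₗᵢ ℝ ℂ).injective
  rw [map_zero]
  refine Lp.ext ?_
  filter_upwards [h, Lp.coeFn_zero ℂ 2 (volume : Measure ℝ)] with k h1 h2
  rw [h1, h2]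
  simp

theorem diagonalizes_momentum :
    Diagonalizes (Lp.fourierTransformₗᵢ ℝ ℂ) (fun k => 2 * Real.pi * k) momentum :=
  ⟨measurable_two_pi_mul, fun φ χ => by rw [momentum_graph, mem_momentumGraph]⟩

open FourierTransform in
theorem schwartz_mem_momentum (f : 𝓢(ℝ, ℂ)) :
    (f.toLp 2 volume, ((-Complex.I) • SchwartzMap.derivCLM ℂ ℂ f).toLp 2 volume) ∈ momentum.graph := by
  rw [momentum_graph, mem_momentumGraph, fourier_toLp, fourier_toLp]
  filter_upwards [(𝓕 f).coeFn_toLp 2, (𝓕 ((-Complex.I) • SchwartzMap.derivCLM ℂ ℂ f)).coeFn_toLp 2]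
    with k h1 h2
  rw [h1, h2, FourierTransform.fourier_smul, smul_apply, SchwartzMap.fourier_coe,
    SchwartzMap.fourier_coe]
  have h3 : (SchwartzMap.derivCLM ℂ ℂ f : ℝ → ℂ) = deriv f := by
    ext x; exact SchwartzMap.derivCLM_apply ℂ f x
  rw [h3, Real.fourier_deriv f.integrable f.differentiable]
  · simp only [smul_eq_mul]
    push_cast
    linear_combination (-(2 * Real.pi * k * 𝓕 (f : ℝ → ℂ) k)) * Complex.I_sq
  · rw [← h3]
    exact (SchwartzMap.derivCLM ℂ ℂ f).integrable

theorem coeFn_deriv_toLp (f : 𝓢(ℝ, ℂ)) :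
    ((-Complex.I) • SchwartzMap.derivCLM ℂ ℂ f).toLp 2 volume =ᵐ[volume]
      fun x => -Complex.I * deriv f x := by
  filter_upwards [((-Complex.I) • SchwartzMap.derivCLM ℂ ℂ f).coeFn_toLp 2] with x hx
  rw [hx, smul_apply, SchwartzMap.derivCLM_apply, smul_eq_mul]

/-- The weak description of -i d/dy: it allows functions with kinks, such as e^{-|y|}, and exhibits
the graph as an intersection of closed conditions. -/
theorem mem_momentum_iff_inner {φ χ : L2} : (φ, χ) ∈ momentum.graph ↔ ∀ f : 𝓢(ℝ, ℂ),
    inner ℂ (f.toLp 2 volume) χ = inner ℂ (((-Complex.I) • SchwartzMap.derivCLM ℂ ℂ f).toLp 2 volume) φ := by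
  constructor
  · intro h f
    exact (diagonalizes_momentum.inner_eq (schwartz_mem_momentum f) h).symm
  · intro h
    rw [momentum_graph, mem_momentumGraph]
    set F := Lp.fourierTransformₗᵢ ℝ ℂ
    have hl1 : LocallyIntegrable (F χ) volume := (Lp.memLp _).locallyIntegrable (by norm_num)
    have hl2 : LocallyIntegrable (fun k => ((2 * Real.pi * k : ℝ) : ℂ) * F φ k) volume := by
      have : LocallyIntegrable (F φ) volume := (Lp.memLp _).locallyIntegrable (by norm_num)
      rw [← locallyIntegrableOn_univ] at this ⊢
      exact this.continuousOn_mul (by fun_prop) isOpen_univ.isLocallyClosed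
    refine ae_eq_of_integral_contDiff_smul_eq hl1 hl2 fun g hg hgs => ?_
    have hgc : ContDiff ℝ (⊤ : ℕ∞) fun x => (g x : ℂ) := Complex.ofRealCLM.contDiff.comp hg
    have hgcs : HasCompactSupport fun x => (g x : ℂ) := hgs.comp_left Complex.ofReal_zero
    -- The test function f is chosen with Fourier transform equal to the given bump; Plancherel then
    -- turns the weak equation into equality of χ̂ and 2πk φ̂ as distributions.
    set u : 𝓢(ℝ, ℂ) := hgcs.toSchwartzMap hgc with hu
    set f : 𝓢(ℝ, ℂ) := FourierTransform.fourierInv u with hf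
    have hFf : F (f.toLp 2 volume) = u.toLp 2 volume := by
      rw [fourier_toLp, hf, FourierTransform.fourier_fourierInv_eq]
    have h1 := h f
    have h2 := schwartz_mem_momentum f
    rw [momentum_graph, mem_momentumGraph] at h2
    have e1 := F.inner_map_map (f.toLp 2 volume) χ
    have e2 := F.inner_map_map (((-Complex.I) • SchwartzMap.derivCLM ℂ ℂ f).toLp 2 volume) φ
    rw [← e1, ← e2, inner_eq_integral, inner_eq_integral] at h1
    have hu' : ∀ x, u x = g x := fun x => rfl
    calc ∫ x, g x • F χ x = ∫ x, conj (F (f.toLp 2 volume) x) * F χ x := by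
          refine integral_congr_ae ?_
          filter_upwards [u.coeFn_toLp 2] with k hk
          rw [hFf, hk, hu', Complex.conj_ofReal, Complex.real_smul]
      _ = _ := h1
      _ = _ := by
          refine integral_congr_ae ?_
          filter_upwards [h2, u.coeFn_toLp 2] with k h3 h4
          have h3' : F (((-Complex.I) • SchwartzMap.derivCLM ℂ ℂ f).toLp 2 volume) k = _ := h3
          rw [h3', hFf, h4, hu', map_mul, Complex.conj_ofReal, Complex.conj_ofReal,
            Complex.real_smul]
          ring

theorem mem_momentum_iff {φ χ : L2} : (φ, χ) ∈ momentum.graph ↔ ∀ f : 𝓢(ℝ, ℂ),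
    ∫ x, conj (f x) * χ x = ∫ x, Complex.I * conj (deriv f x) * φ x := by
  rw [mem_momentum_iff_inner]
  refine forall_congr' fun f => ?_
  rw [inner_eq_integral, inner_eq_integral]
  refine Eq.congr (integral_congr_ae ?_) (integral_congr_ae ?_)
  · filter_upwards [f.coeFn_toLp 2] with x hx
    rw [hx]
  · filter_upwards [coeFn_deriv_toLp f] with x hx
    rw [hx]
    simp

/-- Integration by parts against a Schwartz function has no boundary terms, because all products
involved are integrable on the line. -/
theorem mem_momentum_of_hasDerivAt {φ χ : L2} {h h' : ℝ → ℂ}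
    (hd : ∀ y, HasDerivAt h (h' y) y) (hφ : φ =ᵐ[volume] h)
    (hχ : χ =ᵐ[volume] fun y => -Complex.I * h' y) : (φ, χ) ∈ momentum.graph := by
  rw [mem_momentum_iff]
  intro f
  have hh : MemLp h 2 volume := (memLp_congr_ae hφ).1 (Lp.memLp φ)
  have hh' : MemLp h' 2 volume := by
    have := ((memLp_congr_ae hχ).1 (Lp.memLp χ)).const_mul Complex.I
    refine (memLp_congr_ae (Eventually.of_forall fun x => ?_)).1 this
    change Complex.I * (-Complex.I * h' x) = h' x
    linear_combination (-h' x) * Complex.I_sq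
  have hf' : MemLp (deriv f) 2 volume := by
    have := (SchwartzMap.derivCLM ℂ ℂ f).memLp 2
    exact (memLp_congr_ae (Eventually.of_forall fun x => SchwartzMap.derivCLM_apply ℂ f x)).1 this
  have key := integral_mul_deriv_eq_deriv_mul_of_integrable (u := fun x => conj (f x))
    (u' := fun x => conj (deriv f x)) (v := h) (v' := h')
    (fun x _ => (f.hasDerivAt x).star) (fun x _ => hd x)
    (integrable_conj_mul (f.memLp 2) hh') (integrable_conj_mul hf' hh)
    (integrable_conj_mul (f.memLp 2) hh)
  calc ∫ x, conj (f x) * χ x = ∫ x, -Complex.I * (conj (f x) * h' x) := by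
        refine integral_congr_ae ?_
        filter_upwards [hχ] with x hx
        rw [hx]
        ring
    _ = ∫ x, Complex.I * (conj (deriv f x) * h x) := by
        rw [integral_const_mul, key, integral_const_mul]
        ring
    _ = _ := by
        refine integral_congr_ae ?_
        filter_upwards [hφ] with x hx
        rw [hx]
        ring

/-- Gauge covariance: `-i d/dy` applied to `e^{iG} φ`. -/
theorem phase_mem_momentum {G G' : ℝ → ℝ} (hG : Measurable G) (hd : ∀ y, HasDerivAt G (G' y) y)
    (hG' : BddMeas fun y => (G' y : ℂ)) {φ χ : L2} (h : (φ, χ) ∈ momentum.graph) :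
    (phase G hG φ, phase G hG (χ + bmul _ hG' φ)) ∈ momentum.graph := by
  rw [mem_momentum_iff_inner]
  intro f
  -- The phase is moved onto the test function. As G is only differentiable, e^{-iG}f need not be
  -- Schwartz; it enters as an element of the domain with a classical derivative, paired with φ by
  -- symmetry.
  set e : ℝ → ℂ := fun y => Complex.exp ((-G y : ℝ) * Complex.I) with he
  set F : L2 := (phase G hG).symm (f.toLp 2 volume) with hF
  have hFe : F =ᵐ[volume] fun y => e y * f y := by
    rw [hF, phase_symm_apply]
    filter_upwards [coeFn_bmul (bddMeas_exp hG.neg) (f.toLp 2 volume), f.coeFn_toLp 2] with y h1 h2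
    rw [h1, h2]
    rfl
  set D : L2 := ((-Complex.I) • SchwartzMap.derivCLM ℂ ℂ f).toLp 2 volume
  have hFd : (F, (phase G hG).symm D - bmul _ hG' F) ∈ momentum.graph := by
    refine mem_momentum_of_hasDerivAt (h := fun y => e y * f y)
      (h' := fun y => e y * (-G' y * Complex.I) * f y + e y * deriv f y) (fun y => ?_) hFe ?_
    · exact ((hd y).neg.ofReal_comp.mul_const Complex.I).cexp.mul (f.hasDerivAt y) |>.congr_deriv
        (by simp only [he, Pi.neg_apply]; push_cast; ring)
    · rw [phase_symm_apply]
      filter_upwards [Lp.coeFn_sub (bmul _ (bddMeas_exp hG.neg) D) (bmul _ hG' F),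
        coeFn_bmul (bddMeas_exp hG.neg) D, coeFn_bmul hG' F, hFe, coeFn_deriv_toLp f]
        with y h1 h2 h3 h4 h5
      rw [h1, Pi.sub_apply, h2, h3, h4, h5]
      simp only [he, Pi.neg_apply]
      push_cast
      linear_combination (-(Complex.exp (-G y * Complex.I) * G' y * f y)) * Complex.I_sq
  have h1 := diagonalizes_momentum.inner_eq hFd h
  have h2 : inner ℂ (bmul _ hG' F) φ = inner ℂ F (bmul _ hG' φ) := by
    rw [inner_eq_integral, inner_eq_integral]
    refine integral_congr_ae ?_
    filter_upwards [coeFn_bmul hG' F, coeFn_bmul hG' φ] with y h3 h4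
    rw [h3, h4, map_mul, Complex.conj_ofReal]
    ring
  have h3 : ∀ a b : L2, inner ℂ ((phase G hG).symm a) b = inner ℂ a (phase G hG b) := fun a b => by
    rw [← (phase G hG).inner_map_map, (phase G hG).apply_symm_apply]
  rw [inner_sub_left, h2, h3] at h1
  rw [map_add, inner_add_right, ← h3, ← h3, ← hF, ← h1, sub_add_cancel]

theorem phase_mem_momentum_iff {G G' : ℝ → ℝ} (hG : Measurable G)
    (hd : ∀ y, HasDerivAt G (G' y) y) (hG' : BddMeas fun y => (G' y : ℂ)) {φ χ : L2} :
    (phase G hG φ, phase G hG χ) ∈ momentum.graph ↔ (φ, χ - bmul _ hG' φ) ∈ momentum.graph := by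
  constructor
  · intro h
    have hb : BddMeas fun y => ((-G' y : ℝ) : ℂ) := by
      obtain ⟨C, hC⟩ := hG'.bdd
      refine ⟨by simpa only [Complex.ofReal_neg] using! hG'.meas.neg, C, fun x => ?_⟩
      simpa using hC x
    -- The converse is the same covariance for -G, which undoes the phase.
    have h1 := phase_mem_momentum hG.neg (fun y => (hd y).neg) hb h
    have h2 : ∀ ψ, phase (-G) hG.neg (phase G hG ψ) = ψ := fun ψ =>
      (phase G hG).symm_apply_apply ψ
    rw [map_add, h2, h2] at h1
    convert h1 using 2
    rw [sub_eq_add_neg]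
    congr 1
    refine Lp.ext ?_
    filter_upwards [Lp.coeFn_neg (bmul _ hG' φ), coeFn_bmul hG' φ,
      coeFn_phase hG.neg (bmul _ hb (phase G hG φ)), coeFn_bmul hb (phase G hG φ),
      coeFn_phase hG φ] with y h1 h2 h3 h4 h5
    rw [h1, Pi.neg_apply, h2, h3, h4, h5]
    have h6 : Complex.exp (((-G) y : ℝ) * Complex.I) * Complex.exp (G y * Complex.I) = 1 := by
      rw [← Complex.exp_add]
      simp
    push_cast
    linear_combination (G' y * φ y) * h6
  · intro h
    have := phase_mem_momentum hG hd hG' h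
    rwa [sub_add_cancel] at this

/-! ### Translations -/

/-- The translation `ψ ↦ ψ(· - s)`. -/
def shift (s : ℝ) : L2 →L[ℂ] L2 :=
  (Lp.compMeasurePreservingₗᵢ ℂ (fun x => x - s)
    (measurePreserving_sub_right volume s)).toContinuousLinearMap

theorem coeFn_shift (s : ℝ) (ψ : L2) : shift s ψ =ᵐ[volume] fun x => ψ (x - s) :=
  Lp.coeFn_compMeasurePreserving ψ (measurePreserving_sub_right volume s)

theorem fourier_shift (s : ℝ) (ψ : L2) :
    Lp.fourierTransformₗᵢ ℝ ℂ (shift s ψ) =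
      phase (fun k => -(2 * Real.pi * s) * k) (measurable_const_mul _)
        (Lp.fourierTransformₗᵢ ℝ ℂ ψ) := by
  refine DenseRange.induction_on
    (SchwartzMap.denseRange_toLpCLM (E := ℝ) (F := ℂ) (μ := volume) (p := 2)
      ENNReal.ofNat_ne_top) ψ ?_ fun f => ?_
  · refine isClosed_eq ?_ ?_
    · exact (LinearIsometryEquiv.continuous _).comp (shift s).continuous
    · exact (LinearIsometryEquiv.continuous _).comp (LinearIsometryEquiv.continuous _)
  · have h1 : shift s (f.toLp 2 volume) = (f.compSubConstCLM ℂ s).toLp 2 volume := by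
      refine Lp.ext ?_
      filter_upwards [coeFn_shift s (f.toLp 2 volume), (f.compSubConstCLM ℂ s).coeFn_toLp 2,
        (measurePreserving_sub_right volume s).quasiMeasurePreserving.ae
          (p := fun x => f.toLp 2 volume x = f x) (f.coeFn_toLp 2 volume)]
        with x h1 h2 h3
      rw [h1, h2, h3]
      rfl
    rw [SchwartzMap.toLpCLM_apply, h1, fourier_toLp, fourier_toLp]
    refine Lp.ext ?_
    filter_upwards [(FourierTransform.fourier (f.compSubConstCLM ℂ s)).coeFn_toLp 2,
      (FourierTransform.fourier f).coeFn_toLp 2,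
      coeFn_phase (measurable_const_mul (-(2 * Real.pi * s)))
        ((FourierTransform.fourier f).toLp 2 volume)] with k h2 h3 h4
    rw [h2, h4, h3, SchwartzMap.fourier_coe, SchwartzMap.fourier_coe,
      Real.fourier_real_eq_integral_exp_smul, Real.fourier_real_eq_integral_exp_smul,
      ← integral_add_right_eq_self _ s, ← integral_const_mul]
    refine integral_congr_ae (Eventually.of_forall fun x => ?_)
    simp only [SchwartzMap.compSubConstCLM_apply, add_sub_cancel_right, smul_eq_mul]
    rw [← mul_assoc, ← Complex.exp_add]
    congr 2
    push_cast
    ring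

/-! ### The inversion `x ↦ 1/x` -/

theorem image_inv_compl_zero : (fun x : ℝ => x⁻¹) '' {0}ᶜ = {0}ᶜ := by
  ext x
  constructor
  · rintro ⟨y, hy, rfl⟩
    exact inv_ne_zero hy
  · intro hx
    exact ⟨x⁻¹, inv_ne_zero hx, inv_inv x⟩

theorem restrict_compl_zero : (volume : Measure ℝ).restrict {0}ᶜ = volume :=
  Measure.restrict_eq_self_of_ae_mem (by simp [ae_iff])

theorem hasDerivWithinAt_inv_compl (x : ℝ) (hx : x ∈ ({0}ᶜ : Set ℝ)) :
    HasDerivWithinAt (fun x : ℝ => x⁻¹) (-(x ^ 2)⁻¹) {0}ᶜ x :=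
  (hasDerivAt_inv hx).hasDerivWithinAt

theorem abs_neg_inv_sq (x : ℝ) : |(-(x ^ 2)⁻¹)| = (x ^ 2)⁻¹ := by
  rw [abs_neg, abs_of_nonneg (by positivity)]

/-- Inversion is injective on the complement of the null set {0}, with Jacobian x⁻². -/
theorem lintegral_comp_inv (F : ℝ → ℝ≥0∞) :
    ∫⁻ y, F y⁻¹ = ∫⁻ x, ENNReal.ofReal ((x ^ 2)⁻¹) * F x := by
  have h := lintegral_image_eq_lintegral_abs_deriv_mul (measurableSet_singleton (0 : ℝ)).compl
    hasDerivWithinAt_inv_compl inv_injective.injOn fun y => F y⁻¹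
  simpa only [image_inv_compl_zero, restrict_compl_zero, abs_neg_inv_sq, inv_inv] using h

theorem integral_comp_inv {E : Type*} [NormedAddCommGroup E] [NormedSpace ℝ E] (F : ℝ → E) :
    ∫ y, F y⁻¹ = ∫ x, (x ^ 2)⁻¹ • F x := by
  have h := integral_image_eq_integral_abs_deriv_smul (measurableSet_singleton (0 : ℝ)).compl
    hasDerivWithinAt_inv_compl inv_injective.injOn fun y => F y⁻¹
  simpa only [image_inv_compl_zero, restrict_compl_zero, abs_neg_inv_sq, inv_inv] using h

theorem integrable_comp_inv_iff {E : Type*} [NormedAddCommGroup E] [NormedSpace ℝ E]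
    (F : ℝ → E) : Integrable (fun y => F y⁻¹) ↔ Integrable fun x => (x ^ 2)⁻¹ • F x := by
  have h := integrableOn_image_iff_integrableOn_abs_deriv_smul
    (measurableSet_singleton (0 : ℝ)).compl
    hasDerivWithinAt_inv_compl inv_injective.injOn fun y => F y⁻¹
  simpa only [image_inv_compl_zero, IntegrableOn, restrict_compl_zero, abs_neg_inv_sq, inv_inv]
    using h

/-- Needed to substitute y⁻¹ into identities that hold only almost everywhere. -/
theorem quasiMeasurePreserving_inv :
    Measure.QuasiMeasurePreserving (fun x : ℝ => x⁻¹) volume volume := by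
  refine ⟨measurable_inv, Measure.AbsolutelyContinuous.mk fun s hs h0 => ?_⟩
  rw [Measure.map_apply measurable_inv hs, ← lintegral_indicator_one (measurable_inv hs)]
  have h := lintegral_comp_inv (s.indicator 1)
  refine Eq.trans (lintegral_congr fun y => ?_) (h.trans ?_)
  · rfl
  · rw [lintegral_eq_zero_iff' ?_]
    · filter_upwards [measure_eq_zero_iff_ae_notMem.1 h0] with x hx
      simp [hx]
    · exact ((by fun_prop : Measurable fun x : ℝ => ENNReal.ofReal ((x ^ 2)⁻¹)).mul
        (measurable_one.indicator hs)).aemeasurable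

theorem ae_ne_zero : ∀ᵐ x : ℝ, x ≠ 0 := by simp [ae_iff]

/-- The weight y⁻¹ is the square root of the Jacobian up to sign, so its square cancels the
Jacobian. -/
theorem integrable_sq_inversion_iff (f : ℝ → ℂ) :
    Integrable (fun y => ‖((y⁻¹ : ℝ) : ℂ) * f y⁻¹‖ ^ 2) ↔ Integrable fun x => ‖f x‖ ^ 2 := by
  rw [integrable_comp_inv_iff fun x => ‖(x : ℂ) * f x‖ ^ 2]
  refine integrable_congr ?_
  filter_upwards [ae_ne_zero] with x hx
  rw [norm_mul, mul_pow, Complex.norm_real, Real.norm_eq_abs, sq_abs, smul_eq_mul,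
    inv_mul_cancel_left₀ (pow_ne_zero 2 hx)]

theorem memLp_inversion {f : ℝ → ℂ} (hf : MemLp f 2 volume) :
    MemLp (fun y => ((y⁻¹ : ℝ) : ℂ) * f y⁻¹) 2 volume := by
  have hm : AEStronglyMeasurable (fun y => ((y⁻¹ : ℝ) : ℂ) * f y⁻¹) volume :=
    (by fun_prop : Measurable fun y : ℝ => ((y⁻¹ : ℝ) : ℂ)).aestronglyMeasurable.mul
      (hf.1.comp_quasiMeasurePreserving quasiMeasurePreserving_inv)
  rw [memLp_two_iff_integrable_sq_norm hm, integrable_sq_inversion_iff]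
  exact (memLp_two_iff_integrable_sq_norm hf.1).1 hf

/-- `(J ψ)(y) = y⁻¹ ψ(y⁻¹)` as a linear map. -/
def inversionₗ : L2 →ₗ[ℂ] L2 where
  toFun ψ := (memLp_inversion (Lp.memLp ψ)).toLp (fun y => ((y⁻¹ : ℝ) : ℂ) * ψ y⁻¹)
  map_add' ψ φ := by
    rw [← MemLp.toLp_add]
    refine MemLp.toLp_congr _ _ ?_
    filter_upwards [quasiMeasurePreserving_inv.ae (Lp.coeFn_add ψ φ)] with x hx
    simp only [hx, Pi.add_apply, mul_add]
  map_smul' c ψ := by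
    rw [RingHom.id_apply, ← MemLp.toLp_const_smul]
    refine MemLp.toLp_congr _ _ ?_
    filter_upwards [quasiMeasurePreserving_inv.ae (Lp.coeFn_smul c ψ)] with x hx
    simp only [hx, Pi.smul_apply, smul_eq_mul]
    ring

theorem coeFn_inversionₗ (ψ : L2) :
    inversionₗ ψ =ᵐ[volume] fun y => ((y⁻¹ : ℝ) : ℂ) * ψ y⁻¹ :=
  MemLp.coeFn_toLp (memLp_inversion (Lp.memLp ψ))

theorem inversionₗ_inversionₗ (ψ : L2) : inversionₗ (inversionₗ ψ) = ψ := by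
  refine Lp.ext ?_
  filter_upwards [coeFn_inversionₗ (inversionₗ ψ),
    quasiMeasurePreserving_inv.ae (coeFn_inversionₗ ψ), ae_ne_zero] with x h1 h2 h3
  rw [h1, h2, inv_inv, ← mul_assoc, ← Complex.ofReal_mul, inv_mul_cancel₀ h3, Complex.ofReal_one,
    one_mul]

/-- The unitary involution `(J ψ)(y) = y⁻¹ ψ(y⁻¹)`. -/
def inversion : L2 ≃ₗᵢ[ℂ] L2 where
  toLinearEquiv := LinearEquiv.ofLinearMap inversionₗ inversionₗ
    (LinearMap.ext inversionₗ_inversionₗ) (LinearMap.ext inversionₗ_inversionₗ)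
  norm_map' ψ := by
    have h : ‖inversionₗ ψ‖ ^ 2 = ‖ψ‖ ^ 2 := by
      rw [norm_sq_eq_integral, norm_sq_eq_integral]
      calc ∫ y, ‖inversionₗ ψ y‖ ^ 2 = ∫ y, ‖((y⁻¹ : ℝ) : ℂ) * ψ y⁻¹‖ ^ 2 := by
            refine integral_congr_ae ?_
            filter_upwards [coeFn_inversionₗ ψ] with y hy
            rw [hy]
        _ = ∫ x : ℝ, (x ^ 2)⁻¹ • ‖(x : ℂ) * ψ x‖ ^ 2 :=
            integral_comp_inv fun x : ℝ => ‖(x : ℂ) * ψ x‖ ^ 2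
        _ = _ := by
            refine integral_congr_ae ?_
            filter_upwards [ae_ne_zero] with x hx
            rw [norm_mul, mul_pow, Complex.norm_real, Real.norm_eq_abs, sq_abs, smul_eq_mul,
              inv_mul_cancel_left₀ (pow_ne_zero 2 hx)]
    exact (pow_left_inj₀ (norm_nonneg _) (norm_nonneg _) two_ne_zero).1 h

theorem coeFn_inversion (ψ : L2) :
    inversion ψ =ᵐ[volume] fun y => ((y⁻¹ : ℝ) : ℂ) * ψ y⁻¹ :=
  coeFn_inversionₗ ψ

theorem inversion_inversion (ψ : L2) : inversion (inversion ψ) = ψ := inversionₗ_inversionₗ ψ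

theorem hasDerivAt_inversion_schwartz (f : 𝓢(ℝ, ℂ)) (y : ℝ) :
    HasDerivAt (fun y : ℝ => ((y⁻¹ : ℝ) : ℂ) * f y⁻¹)
      (-((y⁻¹ : ℝ) : ℂ) ^ 2 * f y⁻¹ - ((y⁻¹ : ℝ) : ℂ) ^ 3 * deriv f y⁻¹) y := by
  rcases eq_or_ne y 0 with rfl | hy
  -- The bound |x|³|f(x)| ≤ C at x = 1/y gives |y⁻¹f(1/y)| ≤ Cy², so the derivative at 0 exists and
  -- is 0. The convention 0⁻¹ = 0 makes both the function and the stated derivative vanish there.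
  · obtain ⟨C, hC0, hC⟩ := f.decay 3 0
    have hO : (fun y : ℝ => ((y⁻¹ : ℝ) : ℂ) * f y⁻¹) =O[𝓝 0] fun y => ‖y - 0‖ ^ 2 := by
      refine Asymptotics.IsBigO.of_bound C (Eventually.of_forall fun y => ?_)
      rcases eq_or_ne y 0 with rfl | hy
      · simp
      · have h := hC y⁻¹
        rw [norm_iteratedFDeriv_zero, norm_inv, inv_pow, inv_mul_le_iff₀ (by positivity)] at h
        rw [norm_mul, Complex.norm_real, norm_inv, sub_zero, norm_pow, norm_norm,
          inv_mul_le_iff₀ (by positivity)]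
        calc _ ≤ _ := h
          _ = _ := by ring
    have h := hO.hasFDerivAt (𝕜 := ℝ) (by norm_num : 1 < 2)
    have h' := h.hasDerivAt
    simpa using h'
  · have h1 : HasDerivAt (fun y : ℝ => ((y⁻¹ : ℝ) : ℂ)) ((-(y ^ 2)⁻¹ : ℝ) : ℂ) y :=
      (hasDerivAt_inv hy).ofReal_comp
    have h2 : HasDerivAt (fun y : ℝ => f y⁻¹) ((-(y ^ 2)⁻¹ : ℝ) • deriv f y⁻¹) y :=
      (f.hasDerivAt y⁻¹).scomp y (hasDerivAt_inv hy)
    refine (h1.mul h2).congr_deriv ?_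
    rw [Complex.real_smul]
    push_cast
    ring

/-- The graph of `J (-i d/dy) J`; see `piZero_graph`. -/
def invertedMomentumGraph : Submodule ℂ (L2 × L2) :=
  momentum.graph.comap ((inversion : L2 →ₗ[ℂ] L2).prodMap (inversion : L2 →ₗ[ℂ] L2))

theorem mem_invertedMomentumGraph {φ χ : L2} :
    (φ, χ) ∈ invertedMomentumGraph ↔ (inversion φ, inversion χ) ∈ momentum.graph := Iff.rfl

/-- The chain rule turns i(xf + x²f') into -i d/dy of y⁻¹f(1/y). This is the easy inclusion Π ⊆ JpJ.
-/
theorem piGraph_le : piGraph ≤ invertedMomentumGraph := by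
  rintro _ ⟨f, rfl⟩
  change ((f.toLp 2 volume, (piSchwartz f).toLp 2 volume) : L2 × L2) ∈ invertedMomentumGraph
  rw [mem_invertedMomentumGraph]
  refine mem_momentum_of_hasDerivAt (hasDerivAt_inversion_schwartz f) ?_ ?_
  · filter_upwards [coeFn_inversion (f.toLp 2 volume), quasiMeasurePreserving_inv.ae
      (p := fun x => f.toLp 2 volume x = f x) (f.coeFn_toLp 2 volume)] with y h1 h2
    rw [h1, h2]
  · filter_upwards [coeFn_inversion ((piSchwartz f).toLp 2 volume), quasiMeasurePreserving_inv.ae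
      (p := fun x => (piSchwartz f).toLp 2 volume x = piSchwartz f x)
      ((piSchwartz f).coeFn_toLp 2 volume)] with y h1 h2
    rw [h1, h2, piSchwartz_apply]
    ring

theorem isClosed_momentum_graph : IsClosed (momentum.graph : Set (L2 × L2)) := by
  have h : (momentum.graph : Set (L2 × L2)) = ⋂ f : 𝓢(ℝ, ℂ), {p : L2 × L2 |
      inner ℂ (f.toLp 2 volume) p.2 =
        inner ℂ (((-Complex.I) • SchwartzMap.derivCLM ℂ ℂ f).toLp 2 volume) p.1} := by
    ext ⟨φ, χ⟩
    rw [SetLike.mem_coe, mem_momentum_iff_inner, Set.mem_iInter]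
    rfl
  rw [h]
  exact isClosed_iInter fun f => isClosed_eq (by fun_prop) (by fun_prop)

theorem isClosed_invertedMomentumGraph : IsClosed (invertedMomentumGraph : Set (L2 × L2)) :=
  isClosed_momentum_graph.preimage (f := fun p : L2 × L2 => (inversion p.1, inversion p.2))
    ((inversion.continuous.comp continuous_fst).prodMk (inversion.continuous.comp continuous_snd))

/-! ### The functions `ζ_θ` -/

theorem exp_I_sign (y : ℝ) (hy : y ≠ 0) :
    Complex.exp (Complex.I * (Real.sign y * (Real.pi / 2) : ℝ)) = Complex.I * Real.sign y := by
  rcases lt_or_gt_of_ne hy with h | h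
  · rw [Real.sign_of_neg h, show Complex.I * ((-1 * (Real.pi / 2) : ℝ) : ℂ) =
      -(Real.pi / 2 * Complex.I) by push_cast; ring, Complex.exp_neg, Complex.exp_pi_div_two_mul_I]
    simp
  · rw [Real.sign_of_pos h, show Complex.I * ((1 * (Real.pi / 2) : ℝ) : ℂ) =
      (Real.pi / 2 * Complex.I) by push_cast; ring, Complex.exp_pi_div_two_mul_I]
    simp

theorem coeFn_zeta (θ : ℝ) : zeta θ =ᵐ[volume] zetaFun θ := MemLp.coeFn_toLp (memLp_zetaFun θ)

/-- For θ = 0 this is e^{-|y|}, which is nonzero at y = 0 where inverted Schwartz functions vanish: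
the direction missing from the closure of Π. For θ = π it is i sgn(y)e^{-|y|} = -i d/dy e^{-|y|}. -/
theorem coeFn_inversion_zeta (θ : ℝ) : inversion (zeta θ) =ᵐ[volume]
    fun y => (Real.exp (-|y|) : ℂ) * Complex.exp (Complex.I * (Real.sign y * (θ / 2) : ℝ)) := by
  filter_upwards [coeFn_inversion (zeta θ), quasiMeasurePreserving_inv.ae (coeFn_zeta θ),
    ae_ne_zero] with y h1 h2 h3
  rw [h1, h2, zetaFun, ← mul_assoc, ← Complex.ofReal_mul, inv_inv, inv_mul_cancel_left₀ h3,
    abs_inv, one_div, inv_inv, Real.sign_inv]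

/-- Integrate (u e^{-|x|})' over each half-line. The boundary terms -u(0) and u(0) cancel because
e^{-|x|} is continuous at 0. -/
theorem integral_deriv_mul_exp_neg_abs (u u' : ℝ → ℂ) (hd : ∀ x, HasDerivAt u (u' x) x)
    (hu : Integrable u) (hu' : Integrable u') :
    ∫ x, u x * (Real.sign x * Real.exp (-|x|) : ℝ) = ∫ x, u' x * (Real.exp (-|x|) : ℝ) := by
  have hs : Measurable Real.sign := by
    unfold Real.sign
    exact Measurable.ite measurableSet_Iio measurable_const
      (Measurable.ite measurableSet_Ioi measurable_const measurable_const)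
  have hs1 : ∀ x, |Real.sign x| ≤ 1 := fun x => by
    rcases Real.sign_apply_eq x with h | h | h <;> simp [h]
  have he1 : ∀ x : ℝ, Real.exp (-|x|) ≤ 1 := fun x => by simp
  have hI0 : Integrable fun x => u x * (Real.exp (-|x|) : ℝ) := by
    refine hu.mul_bdd (c := 1) (by fun_prop) (Eventually.of_forall fun x => ?_)
    rw [Complex.norm_real, Real.norm_eq_abs, Real.abs_exp]
    exact he1 x
  have hI1 : Integrable fun x => u x * (Real.sign x * Real.exp (-|x|) : ℝ) := by
    refine hu.mul_bdd (c := 1) (by fun_prop) (Eventually.of_forall fun x => ?_)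
    rw [Complex.norm_real, Real.norm_eq_abs, abs_mul, Real.abs_exp]
    exact mul_le_one₀ (hs1 x) (Real.exp_nonneg _) (he1 x)
  have hI2 : Integrable fun x => u' x * (Real.exp (-|x|) : ℝ) := by
    refine hu'.mul_bdd (c := 1) (by fun_prop) (Eventually.of_forall fun x => ?_)
    rw [Complex.norm_real, Real.norm_eq_abs, Real.abs_exp]
    exact he1 x
  set w : ℝ → ℂ := fun x => u' x * (Real.exp (-|x|) : ℝ) -
    u x * (Real.sign x * Real.exp (-|x|) : ℝ) with hw
  have hwI : Integrable w := hI2.sub hI1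
  have hpos : ∫ x in Set.Ioi 0, w x = 0 - u 0 := by
    have hd' : ∀ x, HasDerivAt (fun x => u x * (Real.exp (-x) : ℝ))
        (u' x * (Real.exp (-x) : ℝ) - u x * (Real.exp (-x) : ℝ)) x := fun x => by
      refine ((hd x).mul (hasDerivAt_neg x).exp.ofReal_comp).congr_deriv ?_
      push_cast
      ring
    have hc : Set.EqOn w (fun x => u' x * (Real.exp (-x) : ℝ) - u x * (Real.exp (-x) : ℝ))
        (Set.Ioi 0) := fun x hx => by
      simp only [hw, abs_of_pos (Set.mem_Ioi.1 hx), Real.sign_of_pos (Set.mem_Ioi.1 hx), one_mul]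
    have hc0 : Set.EqOn (fun x => u x * (Real.exp (-|x|) : ℝ))
        (fun x => u x * (Real.exp (-x) : ℝ)) (Set.Ioi 0) := fun x hx => by
      simp only [abs_of_pos (Set.mem_Ioi.1 hx)]
    have hi := (integrableOn_congr_fun hc measurableSet_Ioi).1 hwI.integrableOn
    have hi0 := (integrableOn_congr_fun hc0 measurableSet_Ioi).1 hI0.integrableOn
    rw [setIntegral_congr_fun measurableSet_Ioi hc, integral_Ioi_of_hasDerivAt_of_tendsto'
      (fun x _ => hd' x) hi (tendsto_zero_of_hasDerivAt_of_integrableOn_Ioi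
        (fun x _ => hd' x) hi hi0)]
    simp
  have hneg : ∫ x in Set.Iic 0, w x = u 0 - 0 := by
    have hd' : ∀ x, HasDerivAt (fun x => u x * (Real.exp x : ℝ))
        (u' x * (Real.exp x : ℝ) + u x * (Real.exp x : ℝ)) x := fun x =>
      (hd x).mul (Real.hasDerivAt_exp x).ofReal_comp
    -- Only the open half-line is possible here: at 0 the sign is 0, so w differs from the smooth
    -- expression there unless u(0) = 0.
    have hc : Set.EqOn w (fun x => u' x * (Real.exp x : ℝ) + u x * (Real.exp x : ℝ))
        (Set.Iio 0) := fun x hx => by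
      simp only [hw, abs_of_neg (Set.mem_Iio.1 hx), Real.sign_of_neg (Set.mem_Iio.1 hx), neg_neg]
      push_cast
      ring
    have hc0 : Set.EqOn (fun x => u x * (Real.exp (-|x|) : ℝ))
        (fun x => u x * (Real.exp x : ℝ)) (Set.Iic 0) := fun x hx => by
      simp only [abs_of_nonpos (Set.mem_Iic.1 hx), neg_neg]
    have hi := (integrableOn_congr_fun hc measurableSet_Iio).1 hwI.integrableOn
    have hi' := (integrableOn_Iic_iff_integrableOn_Iio (by finiteness)).2 hi
    have hi0 := (integrableOn_congr_fun hc0 measurableSet_Iic).1 hI0.integrableOn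
    rw [integral_Iic_eq_integral_Iio, setIntegral_congr_fun measurableSet_Iio hc,
      ← integral_Iic_eq_integral_Iio, integral_Iic_of_hasDerivAt_of_tendsto'
      (fun x _ => hd' x) hi' (tendsto_zero_of_hasDerivAt_of_integrableOn_Iic
        (fun x _ => hd' x) hi' hi0)]
    simp
  have htot : ∫ x, w x = 0 := by
    rw [← intervalIntegral.integral_Iic_add_Ioi hwI.integrableOn hwI.integrableOn, hpos, hneg]
    ring
  rw [hw, integral_sub hI2 hI1] at htot
  exact (sub_eq_zero.1 htot).symm

/-- The kink of e^{-|y|} at 0 excludes the criterion by classical derivatives, so the weak form is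
checked. -/
theorem zeta_mem : (zeta 0, zeta Real.pi) ∈ invertedMomentumGraph := by
  rw [mem_invertedMomentumGraph, mem_momentum_iff]
  intro f
  have key := integral_deriv_mul_exp_neg_abs (fun x => conj (f x)) (fun x => conj (deriv f x))
    (fun x => (f.hasDerivAt x).star) ?_ ?_
  · calc _ = ∫ x, Complex.I * (conj (f x) * (Real.sign x * Real.exp (-|x|) : ℝ)) := by
          refine integral_congr_ae ?_
          filter_upwards [coeFn_inversion_zeta Real.pi, ae_ne_zero] with x h1 h2
          rw [h1, exp_I_sign x h2]
          push_cast
          ring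
      _ = ∫ x, Complex.I * (conj (deriv f x) * (Real.exp (-|x|) : ℝ)) := by
          rw [integral_const_mul, integral_const_mul, key]
      _ = _ := by
          refine integral_congr_ae ?_
          filter_upwards [coeFn_inversion_zeta 0] with x h1
          rw [h1]
          simp
          ring
  · exact (LinearIsometryEquiv.integrable_comp_iff Complex.conjLIE).2 f.integrable
  · have h := (SchwartzMap.derivCLM ℂ ℂ f).integrable (μ := volume)
    exact (LinearIsometryEquiv.integrable_comp_iff Complex.conjLIE).2 h

/-! ### The lemma of du Bois-Reymond -/

/-- The primitive starting at inf K vanishes to the left of K, and beyond sup K because the total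
integral is zero. Order-connectedness keeps [inf K, sup K] inside U. -/
theorem exists_contDiff_deriv_eq {U : Set ℝ} (hU : U.OrdConnected) {h : ℝ → ℝ}
    (hh : ContDiff ℝ (⊤ : ℕ∞) h) {K : Set ℝ} (hK : IsCompact K) (hKne : K.Nonempty) (hKU : K ⊆ U)
    (hs : ∀ x, x ∉ K → h x = 0) (hint : ∫ x, h x = 0) :
    ∃ m : ℝ → ℝ, ContDiff ℝ (⊤ : ℕ∞) m ∧ HasCompactSupport m ∧ tsupport m ⊆ U ∧ deriv m = h := by
  set a := sInf K
  set b := sSup K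
  have haK : a ∈ K := hK.sInf_mem hKne
  have hbK : b ∈ K := hK.sSup_mem hKne
  have hlo : ∀ x, x < a → h x = 0 := fun x hx => hs x fun hxK =>
    not_lt.2 (csInf_le hK.bddBelow hxK) hx
  have hhi : ∀ x, b < x → h x = 0 := fun x hx => hs x fun hxK =>
    not_lt.2 (le_csSup hK.bddAbove hxK) hx
  have hab : a ≤ b := csInf_le hK.bddBelow hbK
  have hc : Continuous h := hh.continuous
  set m : ℝ → ℝ := fun x => ∫ t in a..x, h t with hm
  have hd : deriv m = h := funext fun x => hc.deriv_integral h a x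
  have hdiff : Differentiable ℝ m := fun x =>
    (intervalIntegral.integral_hasDerivAt_right (hc.intervalIntegrable _ _)
      (hc.stronglyMeasurableAtFilter _ _) hc.continuousAt).differentiableAt
  have hsupp : ∀ x, x ∉ Set.Icc a b → m x = 0 := by
    intro x hx
    rcases lt_or_ge x a with h1 | h1
    · rw [hm]
      simp only
      rw [intervalIntegral.integral_symm, intervalIntegral.integral_of_le h1.le,
        ← integral_Ioc_eq_integral_Ioo.symm, setIntegral_eq_zero_of_forall_eq_zero, neg_zero]
      exact fun t ht => hlo t ht.2
    · have h2 : b < x := lt_of_not_ge fun h2 => hx ⟨h1, h2⟩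
      rw [hm]
      simp only
      rw [intervalIntegral.integral_of_le h1, ← integral_Icc_eq_integral_Ioc,
        setIntegral_eq_integral_of_forall_compl_eq_zero, hint]
      intro t ht
      by_cases h3 : t < a
      · exact hlo t h3
      · exact hhi t (lt_trans h2 (lt_of_not_ge fun h4 => ht ⟨not_lt.1 h3, h4⟩))
  have hts : tsupport m ⊆ Set.Icc a b :=
    closure_minimal (fun x hx => by_contra fun h => hx (hsupp x h)) isClosed_Icc
  refine ⟨m, contDiff_infty_iff_deriv.2 ⟨hdiff, by rwa [hd]⟩, ?_, ?_, hd⟩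
  · exact HasCompactSupport.of_support_subset_isCompact isCompact_Icc
      ((subset_tsupport m).trans hts)
  · exact hts.trans (hU.out (hKU haK) (hKU hbK))

/-- A locally integrable function on an open interval with vanishing weak derivative is constant. -/
theorem ae_eq_const_of_integral_deriv_smul_eq_zero {U : Set ℝ} (hUo : IsOpen U)
    (hU : U.OrdConnected) (hne : U.Nonempty) {w : ℝ → ℂ} (hw : LocallyIntegrableOn w U)
    (h : ∀ m : ℝ → ℝ, ContDiff ℝ (⊤ : ℕ∞) m → HasCompactSupport m → tsupport m ⊆ U →
      ∫ x, deriv m x • w x = 0) : ∃ c : ℂ, ∀ᵐ x, x ∈ U → w x = c := by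
  obtain ⟨x₀, hx₀⟩ := hne
  obtain ⟨r, hr, hrU⟩ := Metric.nhds_basis_closedBall.mem_iff.1 (hUo.mem_nhds hx₀)
  let φ : ContDiffBump x₀ := ⟨r / 2, r, by positivity, by linarith⟩
  set m₀ : ℝ → ℝ := φ.normed volume
  have hm₀ : ContDiff ℝ (⊤ : ℕ∞) m₀ := φ.contDiff_normed
  have hm₀c : HasCompactSupport m₀ := φ.hasCompactSupport_normed
  have hm₀t : tsupport m₀ ⊆ U := by
    rw [φ.tsupport_normed_eq]
    exact hrU
  have hm₀i : ∫ x, m₀ x = 1 := φ.integral_normed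
  set c : ℂ := ∫ x, m₀ x • w x
  have hsm : ∀ g : ℝ → ℝ, ContDiff ℝ (⊤ : ℕ∞) g → HasCompactSupport g → tsupport g ⊆ U →
      Integrable fun x => g x • w x := fun g hg hgc hgt => by
    have h1 : IntegrableOn (fun x => g x • w x) (tsupport g) :=
      (hw.integrableOn_compact_subset hgt hgc).continuousOn_smul hg.continuous.continuousOn hgc
    refine (integrableOn_iff_integrable_of_support_subset ?_).1 h1
    exact (Function.support_smul_subset_left g w).trans (subset_tsupport g)
  refine ⟨c, ?_⟩
  have key : ∀ᵐ x, x ∈ U → w x - c = 0 := by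
    refine hUo.ae_eq_zero_of_integral_contDiff_smul_eq_zero
      (hw.sub (continuousOn_const.locallyIntegrableOn hUo.measurableSet)) fun g hg hgc hgt => ?_
    have hgI : Integrable g := hg.continuous.integrable_of_hasCompactSupport hgc
    have hm₀I : Integrable m₀ := hm₀.continuous.integrable_of_hasCompactSupport hm₀c
    -- Subtracting (∫g)m₀, where m₀ has integral 1, makes the mean zero; the difference is then a
    -- derivative of an admissible test function, and testing w with it identifies the constant as ∫
    -- m₀w.
    obtain ⟨m, hm, hmc, hmt, hmd⟩ := exists_contDiff_deriv_eq hU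
      (h := fun x => g x - (∫ y, g y) * m₀ x) (hg.sub (contDiff_const.mul hm₀))
      (K := tsupport g ∪ tsupport m₀) (hgc.isCompact.union hm₀c.isCompact)
      ⟨x₀, Or.inr (by
        rw [φ.tsupport_normed_eq]
        exact Metric.mem_closedBall_self hr.le)⟩ (Set.union_subset hgt hm₀t)
      (fun x hx => by
        rw [image_eq_zero_of_notMem_tsupport fun h => hx (Or.inl h),
          image_eq_zero_of_notMem_tsupport fun h => hx (Or.inr h)]
        simp)
      (by
        rw [integral_sub hgI (hm₀I.const_mul _), integral_const_mul, hm₀i]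
        ring)
    have h0 := h m hm hmc hmt
    rw [hmd] at h0
    have h1 : ∫ x, (g x - (∫ y, g y) * m₀ x) • w x =
        (∫ x, g x • w x) - (∫ y, g y) • c := by
      rw [← integral_smul, ← integral_sub (hsm g hg hgc hgt) 
        (by exact (hsm m₀ hm₀ hm₀c hm₀t).smul (∫ y, g y))]
      refine integral_congr_ae (Eventually.of_forall fun x => ?_)
      simp only [sub_smul, mul_smul]
    rw [h1] at h0
    simp only [smul_sub]
    rw [integral_sub (hsm g hg hgc hgt) (hgI.smul_const c), integral_smul_const, h0]
  filter_upwards [key] with x hx hxU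
  exact sub_eq_zero.1 (hx hxU)

/-! ### The deficiency space of `Π` -/

/-- The range of `Π - i` on Schwartz functions. -/
def piSubIRange : Submodule ℂ L2 :=
  piGraph.map (LinearMap.snd ℂ L2 L2 - Complex.I • LinearMap.fst ℂ L2 L2)

/-- The function x⁻¹e^{-1/x} solves Πu = iu away from 0. Hence (Π - i)(mu) = i x²m'u, and
orthogonality to the range of Π - i leaves only the derivative of m. -/
theorem weak_equation_of_mem_orthogonal {ψ : L2} (hψ : ψ ∈ piSubIRangeᗮ) {m : ℝ → ℝ}
    (hm : ContDiff ℝ (⊤ : ℕ∞) m) (hmc : HasCompactSupport m) (hmt : tsupport m ⊆ {0}ᶜ) :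
    ∫ x, deriv m x • (conj (ψ x) * (x * Real.exp (-x⁻¹) : ℝ)) = 0 := by
  -- Although u = x⁻¹e^{-1/x} is singular at 0, the product is smooth with compact support because m
  -- vanishes near 0.
  set F : ℝ → ℝ := fun x => m x * (x⁻¹ * Real.exp (-x⁻¹)) with hF
  have hFt : tsupport F ⊆ tsupport m := tsupport_mul_subset_left
  have hFs : ContDiff ℝ (⊤ : ℕ∞) F := by
    refine contDiff_iff_contDiffAt.2 fun x => ?_
    by_cases hx : x ∈ tsupport F
    swap
    · exact contDiffAt_const.congr_of_eventuallyEq (notMem_tsupport_iff_eventuallyEq.1 hx)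
    have hx0 : x ≠ 0 := hmt (hFt hx)
    exact hm.contDiffAt.mul ((contDiffAt_inv ℝ hx0).mul (contDiffAt_inv ℝ hx0).neg.exp)
  have hFc : HasCompactSupport F := hmc.mul_right
  have hfs : ContDiff ℝ (⊤ : ℕ∞) fun x => (F x : ℂ) := Complex.ofRealCLM.contDiff.comp hFs
  have hfc : HasCompactSupport fun x => (F x : ℂ) := hFc.comp_left Complex.ofReal_zero
  set f : 𝓢(ℝ, ℂ) := hfc.toSchwartzMap hfs with hf
  have hfx : ∀ x, f x = F x := fun x => rfl
  have hdF : ∀ x : ℝ, x ≠ 0 → HasDerivAt F (deriv m x * (x⁻¹ * Real.exp (-x⁻¹)) +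
      m x * (-(x ^ 2)⁻¹ * Real.exp (-x⁻¹) +
        x⁻¹ * (Real.exp (-x⁻¹) * -(-(x ^ 2)⁻¹)))) x := fun x hx =>
    (hm.differentiable (by simp) x).hasDerivAt.mul
      ((hasDerivAt_inv hx).mul (hasDerivAt_inv hx).neg.exp)
  have hmem : (piSchwartz f).toLp 2 volume - Complex.I • f.toLp 2 volume ∈ piSubIRange :=
    ⟨(f.toLp 2 volume, (piSchwartz f).toLp 2 volume), ⟨f, rfl⟩, rfl⟩
  have h0 := (Submodule.mem_orthogonal' _ _).1 hψ _ hmem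
  rw [inner_eq_integral] at h0
  have h1 : ∫ x, conj (ψ x) * ((piSchwartz f).toLp 2 volume - Complex.I • f.toLp 2 volume : L2) x =
      ∫ x, Complex.I * (deriv m x • (conj (ψ x) * (x * Real.exp (-x⁻¹) : ℝ))) := by
    refine integral_congr_ae ?_
    filter_upwards [Lp.coeFn_sub ((piSchwartz f).toLp 2 volume) (Complex.I • f.toLp 2 volume),
      Lp.coeFn_smul Complex.I (f.toLp 2 volume), (piSchwartz f).coeFn_toLp 2 volume,
      f.coeFn_toLp 2 volume, ae_ne_zero] with x h1 h2 h3 h4 h5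
    rw [h1, Pi.sub_apply, h2, Pi.smul_apply, h3, h4, piSchwartz_apply, hfx,
      (show HasDerivAt f _ x from (hdF x h5).ofReal_comp).deriv, hF]
    have hx : (x : ℂ) ≠ 0 := Complex.ofReal_ne_zero.2 h5
    simp only [smul_eq_mul, Complex.real_smul]
    push_cast
    field_simp
    ring
  rw [h1, integral_const_mul] at h0
  exact (mul_eq_zero.1 h0).resolve_left Complex.I_ne_zero

theorem exists_const_of_mem_orthogonal {ψ : L2} (hψ : ψ ∈ piSubIRangeᗮ) {U : Set ℝ}
    (hUo : IsOpen U) (hU : U.OrdConnected) (hne : U.Nonempty) (h0 : U ⊆ {0}ᶜ) :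
    ∃ c : ℂ, ∀ᵐ x, x ∈ U → ψ x = c * (x⁻¹ * Real.exp x⁻¹ : ℝ) := by
  have hψl : LocallyIntegrable (fun x => conj (ψ x)) volume :=
    (Lp.memLp ψ).star.locallyIntegrable (by norm_num)
  have hcont : ContinuousOn (fun x : ℝ => ((x * Real.exp (-x⁻¹) : ℝ) : ℂ)) U := by
    refine Complex.continuous_ofReal.comp_continuousOn ?_
    have hi : ContinuousOn (fun x : ℝ => x⁻¹) U := continuousOn_id.inv₀ fun x hx => h0 hx
    exact continuousOn_id.mul (Real.continuous_exp.comp_continuousOn hi.neg)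
  obtain ⟨c, hc⟩ := ae_eq_const_of_integral_deriv_smul_eq_zero hUo hU hne
    (w := fun x => conj (ψ x) * (x * Real.exp (-x⁻¹) : ℝ))
    ((hψl.locallyIntegrableOn U).mul_continuousOn hcont hUo.isLocallyClosed)
    fun m hm hmc hmt => weak_equation_of_mem_orthogonal hψ hm hmc (hmt.trans h0)
  refine ⟨conj c, ?_⟩
  filter_upwards [hc] with x hx hxU
  rw [← hx hxU, map_mul, Complex.conj_conj, Complex.conj_ofReal, mul_assoc, ← Complex.ofReal_mul]
  have hx0 : x ≠ 0 := h0 hxU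
  have h1 : x * Real.exp (-x⁻¹) * (x⁻¹ * Real.exp x⁻¹) = 1 := by
    rw [Real.exp_neg]
    field_simp
  rw [h1, Complex.ofReal_one, mul_one]

theorem coeFn_zeta_pi_sub : (zeta Real.pi - Complex.I • zeta 0 : L2) =ᵐ[volume] fun x =>
    ((x⁻¹ * Real.exp (-(1 / |x|)) : ℝ) : ℂ) * (Complex.I * (Real.sign x - 1)) := by
  filter_upwards [Lp.coeFn_sub (zeta Real.pi) (Complex.I • zeta 0),
    Lp.coeFn_smul Complex.I (zeta 0), coeFn_zeta 0, coeFn_zeta Real.pi, ae_ne_zero]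
    with x h1 h2 h3 h4 h5
  rw [h1, Pi.sub_apply, h2, Pi.smul_apply, h3, h4, zetaFun, zetaFun, exp_I_sign x h5]
  simp
  ring

/-- On each half-line ψ is a multiple of x⁻¹e^{1/x}. This is not square integrable near 0⁺, so ψ
vanishes for x > 0 and a single constant remains, the one for x < 0. -/
theorem orthogonal_piSubIRange_le :
    piSubIRangeᗮ ≤ Submodule.span ℂ {zeta Real.pi - Complex.I • zeta 0} := by
  intro ψ hψ
  obtain ⟨c, hc⟩ := exists_const_of_mem_orthogonal hψ isOpen_Ioi Set.ordConnected_Ioi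
    ⟨(1 : ℝ), Set.mem_Ioi.2 one_pos⟩ fun x hx => (Set.mem_Ioi.1 hx).ne'
  obtain ⟨d, hd⟩ := exists_const_of_mem_orthogonal hψ isOpen_Iio Set.ordConnected_Iio
    ⟨(-1 : ℝ), Set.mem_Iio.2 (by norm_num)⟩ fun x hx => (Set.mem_Iio.1 hx).ne
  have hc0 : c = 0 := by
    -- If c ≠ 0, then on (0, 1] one has |ψ|²/|c|² = x⁻²e^{2/x} ≥ 1/x, which would make 1/x
    -- integrable at 0.
    by_contra hc0
    have hI : IntegrableOn (fun x => (‖c‖ ^ 2)⁻¹ * ‖ψ x‖ ^ 2) (Set.Ioc 0 1) :=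
      (((memLp_two_iff_integrable_sq_norm (Lp.aestronglyMeasurable ψ)).1
        (Lp.memLp ψ)).const_mul _).integrableOn
    have hinv : IntegrableOn (fun x : ℝ => x⁻¹) (Set.Ioc 0 1) := by
      refine hI.mono' (by fun_prop) ?_
      filter_upwards [ae_restrict_mem measurableSet_Ioc, ae_restrict_of_ae hc] with x hx hxc
      have hx0 : 0 < x := hx.1
      have hnc : 0 < ‖c‖ := norm_pos_iff.2 hc0
      rw [hxc hx0, norm_mul, mul_pow, inv_mul_cancel_left₀ (by positivity), Complex.norm_real,
        Real.norm_of_nonneg (by positivity), Real.norm_of_nonneg (by positivity)]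
      have h1 : 1 ≤ x⁻¹ := (one_le_inv₀ hx0).2 hx.2
      have h2 : 1 ≤ Real.exp x⁻¹ := Real.one_le_exp (by positivity)
      nlinarith [mul_le_mul h1 h2 zero_le_one (by positivity)]
    have := intervalIntegrable_inv_iff.1
      ((intervalIntegrable_iff_integrableOn_Ioc_of_le zero_le_one).2 hinv)
    simp at this
  rw [Submodule.mem_span_singleton]
  -- On x < 0 the spanning vector ζ_π - iζ₀ equals -2i x⁻¹e^{1/x}, and on x > 0 it is zero.
  refine ⟨d * (-2 * Complex.I)⁻¹, ?_⟩
  refine Lp.ext ?_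
  filter_upwards [hc, hd, coeFn_zeta_pi_sub, ae_ne_zero,
    Lp.coeFn_smul (d * (-2 * Complex.I)⁻¹) (zeta Real.pi - Complex.I • zeta 0)]
    with x h1 h2 h3 h4 h5
  rw [h5, Pi.smul_apply, h3]
  rcases lt_or_gt_of_ne h4 with h | h
  · rw [h2 h, Real.sign_of_neg h, abs_of_neg h]
    have : -(1 / -x) = x⁻¹ := by rw [one_div, inv_neg, neg_neg]
    rw [this, smul_eq_mul]
    have hI := Complex.I_ne_zero
    field_simp
    push_cast
    ring
  · rw [h1 h, hc0, Real.sign_of_pos h]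
    simp

/-! ### Identification of Π₀ with the inverted momentum operator -/

theorem closure_piSubIRange_sup :
    piSubIRange.topologicalClosure ⊔ Submodule.span ℂ {zeta Real.pi - Complex.I • zeta 0} = ⊤ := by
  set N : Submodule ℂ L2 := Submodule.span ℂ {zeta Real.pi - Complex.I • zeta 0}
  -- Taking orthogonal complements of the deficiency bound; the double complement of the range is
  -- its closure.
  have h1 : Nᗮ ≤ piSubIRange.topologicalClosure := by
    rw [← Submodule.orthogonal_orthogonal_eq_closure]
    exact Submodule.orthogonal_le orthogonal_piSubIRange_le
  rw [eq_top_iff, ← Submodule.sup_orthogonal_of_hasOrthogonalProjection (K := N), sup_comm]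
  exact sup_le_sup_right h1 N

/-- The resolvent at `i` of the operator with graph `invertedMomentumGraph`. -/
def invertedResolvent : L2 →L[ℂ] L2 :=
  (inversion.toContinuousLinearEquiv : L2 →L[ℂ] L2).comp
    ((diagonalizes_momentum.resolvent Complex.I Diagonalizes.I_im_ne).comp
      (inversion.toContinuousLinearEquiv : L2 →L[ℂ] L2))

theorem invertedResolvent_iff (φ u : L2) :
    (φ, u + Complex.I • φ) ∈ invertedMomentumGraph ↔ φ = invertedResolvent u := by
  rw [mem_invertedMomentumGraph, map_add, map_smul,
    diagonalizes_momentum.resolvent_iff Diagonalizes.I_im_ne]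
  change _ ↔ φ = inversion _
  constructor
  · intro h
    rw [← inversion_inversion φ, h]
    rfl
  · rintro rfl
    rw [inversion_inversion]
    rfl

/-- The left side is contained in the graph of JpJ, and on that graph (f, g) ↦ g - if is a bijection
onto L². It therefore suffices that the smaller graph already has full image, which is
`closure_piSubIRange_sup`. -/
theorem piZeroGraph_eq : piGraph.topologicalClosure ⊔
    Submodule.span ℂ {(zeta 0, zeta Real.pi)} = invertedMomentumGraph := by
  refine le_antisymm (sup_le ?_ ?_) ?_
  · exact Submodule.topologicalClosure_minimal _ piGraph_le isClosed_invertedMomentumGraph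
  · rw [Submodule.span_singleton_le_iff_mem]
    exact zeta_mem
  · set P := piGraph.topologicalClosure ⊔ Submodule.span ℂ {(zeta 0, zeta Real.pi)}
    -- The continuous inverse of (f, g) ↦ g - if on the graph of JpJ. Continuity lets the closure of
    -- the range of Π - i be lifted to the closure of the graph of Π.
    set τ : L2 →L[ℂ] L2 × L2 := invertedResolvent.prod
      (ContinuousLinearMap.id ℂ L2 + Complex.I • invertedResolvent) with hτ
    have hτmem : ∀ f g : L2, (f, g) ∈ invertedMomentumGraph →
        τ (g - Complex.I • f) = (f, g) := by
      intro f g h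
      have h1 := (invertedResolvent_iff f (g - Complex.I • f)).1 (by rwa [sub_add_cancel])
      change (invertedResolvent _, (g - Complex.I • f) + Complex.I • invertedResolvent _) = _
      rw [← h1, sub_add_cancel]
    have hτP : ⊤ ≤ P.comap (τ : L2 →ₗ[ℂ] L2 × L2) := by
      rw [← closure_piSubIRange_sup]
      refine sup_le ?_ ?_
      · have h2 : piSubIRange.topologicalClosure ≤
            piGraph.topologicalClosure.comap (τ : L2 →ₗ[ℂ] L2 × L2) := by
          refine Submodule.topologicalClosure_minimal _ ?_
            (piGraph.isClosed_topologicalClosure.preimage τ.continuous)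
          rintro _ ⟨⟨f, g⟩, hfg, rfl⟩
          have h3 := hτmem f g (piGraph_le hfg)
          change τ (g - Complex.I • f) ∈ piGraph.topologicalClosure
          rw [h3]
          exact piGraph.le_topologicalClosure hfg
        exact h2.trans (Submodule.comap_mono le_sup_left)
      · rw [Submodule.span_singleton_le_iff_mem]
        change τ (zeta Real.pi - Complex.I • zeta 0) ∈ P
        rw [hτmem _ _ zeta_mem]
        exact Submodule.mem_sup_right (Submodule.mem_span_singleton_self _)
    rintro ⟨f, g⟩ h
    rw [← hτmem f g h]
    exact hτP (Submodule.mem_top)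

theorem piZero_graph : piZero.graph = invertedMomentumGraph := by
  rw [piZero, Submodule.toLinearPMap_graph_eq, piZeroGraph_eq]
  rw [piZeroGraph_eq]
  rintro ⟨φ, χ⟩ h h0
  have h0' : φ = 0 := h0
  rw [mem_invertedMomentumGraph, h0', map_zero] at h
  have := momentum.graph_fst_eq_zero_snd h rfl
  exact (map_eq_zero_iff _ inversion.injective).1 this

/-! ### Convolution operators in momentum space -/

/-- The unnormalized Fourier integral `∫ e^{-ikx} g(x) dx`. -/
def fourierInt (g : ℝ → ℂ) (k : ℝ) : ℂ := ∫ x : ℝ, Complex.exp ((-x * k : ℝ) * Complex.I) * g x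

theorem norm_fourierInt_le (g : ℝ → ℂ) (k : ℝ) : ‖fourierInt g k‖ ≤ ∫ x, ‖g x‖ := by
  refine (norm_integral_le_integral_norm _).trans_eq ?_
  simp only [norm_mul, Complex.norm_exp_ofReal_mul_I, one_mul]

theorem continuous_fourierInt {g : ℝ → ℂ} (hg : Integrable g) : Continuous (fourierInt g) := by
  refine continuous_of_dominated (bound := fun x => ‖g x‖) (fun k => ?_) (fun k => ?_) hg.norm ?_
  · exact (by fun_prop : Continuous fun x : ℝ =>
      Complex.exp ((-x * k : ℝ) * Complex.I)).aestronglyMeasurable.mul hg.1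
  · refine Eventually.of_forall fun x => ?_
    rw [norm_mul, Complex.norm_exp_ofReal_mul_I, one_mul]
  · exact Eventually.of_forall fun x => by fun_prop

theorem bddMeas_fourierInt {g : ℝ → ℂ} (hg : Integrable g) : BddMeas (fourierInt g) :=
  ⟨(continuous_fourierInt hg).measurable, _, norm_fourierInt_le g⟩

theorem gHat_eq (g : ℝ → ℂ) (k : ℝ) :
    gHat g k = ((√(2 * Real.pi))⁻¹ : ℝ) * fourierInt g k := by
  rw [gHat, fourierInt]
  congr 1
  refine integral_congr_ae (Eventually.of_forall fun x => ?_)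
  simp only
  congr 2
  push_cast
  ring

/-- The Riemann–Lebesgue lemma; after inversion it controls the potential at y = 0. -/
theorem tendsto_fourierInt (g : ℝ → ℂ) : Tendsto (fourierInt g) (cocompact ℝ) (𝓝 0) := by
  have h1 : Tendsto (fun k : ℝ => (2 * Real.pi)⁻¹ * k) (cocompact ℝ) (cocompact ℝ) :=
    (Homeomorph.mulLeft₀ (2 * Real.pi)⁻¹ (by positivity)).isClosedEmbedding.tendsto_cocompact
  refine ((Real.zero_at_infty_fourier g).comp h1).congr fun k => ?_
  rw [Function.comp_apply, Real.fourier_real_eq_integral_exp_smul, fourierInt]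
  refine integral_congr_ae (Eventually.of_forall fun x => ?_)
  simp only [smul_eq_mul]
  congr 3
  have := Real.pi_ne_zero
  push_cast
  field_simp

theorem conj_fourierInt {g : ℝ → ℂ} (hsymm : ∀ᵐ x : ℝ, g (-x) = conj (g x)) (k : ℝ) :
    conj (fourierInt g k) = fourierInt g k := by
  rw [fourierInt, ← integral_conj, ← integral_neg_eq_self
    (fun x : ℝ => Complex.exp ((-x * k : ℝ) * Complex.I) * g x)]
  refine integral_congr_ae ?_
  filter_upwards [hsymm] with x hx
  rw [hx, map_mul, ← Complex.exp_conj, map_mul, Complex.conj_I, Complex.conj_ofReal]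
  congr 2
  push_cast
  ring

theorem integrable_conv_kernel {g : ℝ → ℂ} (hg : Integrable g) (ξ ψ : L2) :
    Integrable (fun p : ℝ × ℝ => conj (ξ p.1) * (g p.2 * ψ (p.1 - p.2)))
      (volume.prod volume) := by
  have hm : AEStronglyMeasurable (fun p : ℝ × ℝ => conj (ξ p.1) * (g p.2 * ψ (p.1 - p.2)))
      (volume.prod volume) := by
    have h1 : AEStronglyMeasurable (fun p : ℝ × ℝ => conj (ξ p.1)) (volume.prod volume) :=
      (Lp.aestronglyMeasurable ξ).star.comp_fst
    have h2 : AEStronglyMeasurable (fun p : ℝ × ℝ => g p.2) (volume.prod volume) :=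
      hg.1.comp_snd
    have h3 : AEStronglyMeasurable (fun p : ℝ × ℝ => ψ (p.1 - p.2)) (volume.prod volume) :=
      (Lp.aestronglyMeasurable ψ).comp_quasiMeasurePreserving
        (quasiMeasurePreserving_sub volume volume)
    exact h1.mul (h2.mul h3)
  have hS : ∀ z : ℝ, MemLp (fun x => ψ (x - z)) 2 volume := fun z =>
    (Lp.memLp ψ).comp_measurePreserving (measurePreserving_sub_right volume z)
  have hI : ∀ z : ℝ, Integrable fun x => conj (ξ x) * ψ (x - z) := fun z =>
    integrable_conj_mul (Lp.memLp ξ) (hS z)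
  rw [integrable_prod_iff' hm]
  refine ⟨Eventually.of_forall fun z => ?_, ?_⟩
  · refine ((hI z).const_mul (g z)).congr (Eventually.of_forall fun x => ?_)
    simp only
    ring
  -- |ab| ≤ |a|² + |b|² together with translation invariance bounds the inner integral by ‖g z‖
  -- times a constant independent of z.
  · refine (hg.norm.mul_const (‖ξ‖ ^ 2 + ‖ψ‖ ^ 2)).mono' hm.norm.prod_swap.integral_prod_right'
      (Eventually.of_forall fun z => ?_)
    rw [Real.norm_of_nonneg (integral_nonneg fun _ => norm_nonneg _)]
    have hsq : ∀ f : L2, Integrable fun x => ‖f x‖ ^ 2 := fun f =>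
      (memLp_two_iff_integrable_sq_norm (Lp.aestronglyMeasurable f)).1 (Lp.memLp f)
    have hsq' := (hsq ψ).comp_sub_right z
    have h2 : ∫ x, ‖ψ (x - z)‖ ^ 2 = ‖ψ‖ ^ 2 := by
      rw [norm_sq_eq_integral, integral_sub_right_eq_self (fun x => ‖ψ x‖ ^ 2) z]
    calc ∫ x, ‖conj (ξ x) * (g z * ψ (x - z))‖
        = ‖g z‖ * ∫ x, ‖conj (ξ x) * ψ (x - z)‖ := by
          rw [← integral_const_mul]
          refine integral_congr_ae (Eventually.of_forall fun x => ?_)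
          simp only [norm_mul]
          ring
      _ ≤ ‖g z‖ * ∫ x, (‖ξ x‖ ^ 2 + ‖ψ (x - z)‖ ^ 2) := by
          refine mul_le_mul_of_nonneg_left ?_ (norm_nonneg _)
          refine integral_mono (hI z).norm ((hsq ξ).add hsq') fun x => ?_
          simp only [norm_mul, RCLike.norm_conj]
          nlinarith [sq_nonneg (‖ξ x‖ - ‖ψ (x - z)‖), sq_nonneg (‖ξ x‖), sq_nonneg ‖ψ (x - z)‖]
      _ = _ := by
          rw [integral_add (hsq ξ) hsq', h2, ← norm_sq_eq_integral]

/-- Convolution is the weak superposition of translations with weight g, so its conjugation by a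
unitary is determined by what the unitary does to translations. -/
theorem inner_convOp {g : ℝ → ℂ} (hg : Integrable g) (ξ ψ : L2) :
    inner ℂ ξ (convOp g hg ψ) = ∫ z, g z * inner ℂ ξ (shift z ψ) := by
  have h1 : inner ℂ ξ (convOp g hg ψ) = ∫ x, ∫ z, conj (ξ x) * (g z * ψ (x - z)) := by
    rw [inner_eq_integral]
    refine integral_congr_ae ?_
    filter_upwards [MemLp.coeFn_toLp (memLp_conv hg ψ)] with x hx
    have hx' : convOp g hg ψ x = ∫ y, g (x - y) * ψ y := hx
    rw [hx', integral_const_mul, ← integral_sub_left_eq_self (fun y => g (x - y) * ψ y) volume x]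
    simp only [sub_sub_cancel]
  rw [h1, integral_integral_swap (integrable_conv_kernel hg ξ ψ)]
  refine integral_congr_ae (Eventually.of_forall fun z => ?_)
  simp only
  rw [inner_eq_integral, ← integral_const_mul]
  refine integral_congr_ae ?_
  filter_upwards [coeFn_shift z ψ] with x hx
  rw [hx]
  ring

/-- A unitary operator that turns translations into modulations turns the convolution with `g` into
the multiplication by the Fourier integral of `g`. -/
theorem map_convOp {Q : L2 ≃ₗᵢ[ℂ] L2}
    (hQ : ∀ (z : ℝ) (ψ : L2), Q (shift z ψ) =
      phase (fun k => -z * k) (measurable_const_mul _) (Q ψ))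
    {g : ℝ → ℂ} (hg : Integrable g) (ψ : L2) :
    Q (convOp g hg ψ) = bmul _ (bddMeas_fourierInt hg) (Q ψ) := by
  refine ext_inner_left ℂ fun η => ?_
  obtain ⟨ξ, rfl⟩ := Q.surjective η
  rw [Q.inner_map_map, inner_convOp]
  have hI : Integrable (fun p : ℝ × ℝ => g p.1 * (conj (Q ξ p.2) * Q ψ p.2) *
      Complex.exp ((-p.1 * p.2 : ℝ) * Complex.I)) (volume.prod volume) := by
    refine (hg.mul_prod (integrable_conj_mul (Lp.memLp (Q ξ)) (Lp.memLp (Q ψ)))).mul_bdd (c := 1)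
      (by fun_prop) (Eventually.of_forall fun p => ?_)
    exact (Complex.norm_exp_ofReal_mul_I _).le
  calc ∫ z, g z * inner ℂ ξ (shift z ψ)
      = ∫ z, ∫ k, g z * (conj (Q ξ k) * Q ψ k) * Complex.exp ((-z * k : ℝ) * Complex.I) := by
        refine integral_congr_ae (Eventually.of_forall fun z => ?_)
        simp only
        rw [← Q.inner_map_map, hQ, inner_eq_integral, ← integral_const_mul]
        refine integral_congr_ae ?_
        filter_upwards [coeFn_phase (measurable_const_mul (-z)) (Q ψ)] with k hk
        rw [hk]
        ring
    _ = ∫ k, ∫ z, g z * (conj (Q ξ k) * Q ψ k) * Complex.exp ((-z * k : ℝ) * Complex.I) :=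
        integral_integral_swap hI
    _ = _ := by
        rw [inner_eq_integral]
        refine integral_congr_ae ?_
        filter_upwards [coeFn_bmul (bddMeas_fourierInt hg) (Q ψ)] with k hk
        rw [hk, fourierInt, ← integral_mul_const, ← integral_const_mul]
        refine integral_congr_ae (Eventually.of_forall fun z => ?_)
        simp only
        ring

theorem coeFn_fourierL2 (ψ : L2) : fourierL2 ψ =ᵐ[volume] fun k =>
    ((√(2 * Real.pi)⁻¹ : ℝ) : ℂ) * Lp.fourierTransformₗᵢ ℝ ℂ ψ ((2 * Real.pi)⁻¹ * k) :=
  coeFn_dilationₗ _ (by positivity) _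

theorem fourierL2_shift (z : ℝ) (ψ : L2) : fourierL2 (shift z ψ) =
    phase (fun k => -z * k) (measurable_const_mul _) (fourierL2 ψ) := by
  refine Lp.ext ?_
  have hpi : (2 * Real.pi)⁻¹ ≠ 0 := by positivity
  have h0 := coeFn_phase (measurable_const_mul (-(2 * Real.pi * z)))
    (Lp.fourierTransformₗᵢ ℝ ℂ ψ)
  rw [← fourier_shift] at h0
  filter_upwards [coeFn_fourierL2 (shift z ψ), coeFn_fourierL2 ψ, ae_comp_mul hpi h0,
    coeFn_phase (measurable_const_mul (-z)) (fourierL2 ψ)] with k h1 h2 h3 h4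
  rw [h1, h3, h4, h2]
  have h5 : -(2 * Real.pi * z) * ((2 * Real.pi)⁻¹ * k) = -z * k := by
    have := Real.pi_ne_zero
    field_simp
  rw [h5]
  ring

theorem shift_shift (s t : ℝ) (ψ : L2) : shift s (shift t ψ) = shift (s + t) ψ := by
  refine Lp.ext ?_
  filter_upwards [coeFn_shift s (shift t ψ), coeFn_shift (s + t) ψ,
    (measurePreserving_sub_right volume s).quasiMeasurePreserving.ae (coeFn_shift t ψ)]
    with x h1 h2 h3
  rw [h1, h3, h2, sub_sub]

theorem translation_apply (lam : ℝ) (ψ : L2) : translation lam ψ = shift (1 / lam) ψ := rfl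

/-- The unitary operator `ψ ↦ J F S_λ ψ`. -/
def invertedFourier (lam : ℝ) : L2 ≃ₗᵢ[ℂ] L2 :=
  ((translation lam).trans fourierL2).trans inversion

/-- `translation lam` commutes with every shift, so it does not affect how the convolution is
represented. -/
theorem translation_fourierL2_shift (lam z : ℝ) (ψ : L2) :
    ((translation lam).trans fourierL2) (shift z ψ) =
      phase (fun k => -z * k) (measurable_const_mul _) (((translation lam).trans fourierL2) ψ) := by
  change fourierL2 (translation lam (shift z ψ)) = phase _ _ (fourierL2 (translation lam ψ))
  rw [translation_apply, translation_apply, shift_shift, add_comm, ← shift_shift, fourierL2_shift]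

/-- The potential `y ↦ √(2π) ĝ(1/y)`, extended by `0` to `y = 0`. -/
def potential (g : ℝ → ℂ) (y : ℝ) : ℝ := if y = 0 then 0 else (fourierInt g y⁻¹).re

theorem potential_of_ne_zero (g : ℝ → ℂ) {y : ℝ} (hy : y ≠ 0) :
    potential g y = (fourierInt g y⁻¹).re := if_neg hy

theorem ofReal_potential {g : ℝ → ℂ} (hsymm : ∀ᵐ x : ℝ, g (-x) = conj (g x)) {y : ℝ}
    (hy : y ≠ 0) : (potential g y : ℂ) = fourierInt g y⁻¹ := by
  rw [potential_of_ne_zero g hy]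
  exact Complex.conj_eq_iff_re.1 (conj_fourierInt hsymm _)

theorem abs_potential_le (g : ℝ → ℂ) (y : ℝ) : |potential g y| ≤ ∫ x, ‖g x‖ := by
  by_cases hy : y = 0
  · rw [potential, if_pos hy, abs_zero]
    exact integral_nonneg fun _ => norm_nonneg _
  · rw [potential_of_ne_zero g hy]
    exact (Complex.abs_re_le_norm _).trans (norm_fourierInt_le g _)

/-- As y → 0 the argument 1/y escapes to infinity, where the Fourier integral vanishes; the value 0
at y = 0 is thus the continuous one. Continuity makes the gauge function differentiable everywhere.
-/
theorem continuous_potential {g : ℝ → ℂ} (hg : Integrable g) : Continuous (potential g) := by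
  refine continuous_iff_continuousAt.2 fun y => ?_
  rcases eq_or_ne y 0 with rfl | hy
  · rw [← continuousWithinAt_compl_self, ContinuousWithinAt]
    have h0 : potential g 0 = 0 := if_pos rfl
    rw [h0]
    have h1 : Tendsto (fun y : ℝ => (fourierInt g y⁻¹).re) (𝓝[{0}ᶜ] 0) (𝓝 0) := by
      have h2 := (Complex.continuous_re.tendsto 0).comp
        ((tendsto_fourierInt g).comp
          (Metric.cobounded_eq_cocompact (α := ℝ) ▸ tendsto_inv₀_nhdsNE_zero))
      simpa using! h2
    refine h1.congr' ?_
    filter_upwards [self_mem_nhdsWithin] with x hx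
    exact (potential_of_ne_zero g hx).symm
  · have h1 : ContinuousAt (fun y : ℝ => (fourierInt g y⁻¹).re) y :=
      Complex.continuous_re.continuousAt.comp
        ((continuous_fourierInt hg).continuousAt.comp (continuousAt_inv₀ hy))
    refine h1.congr ?_
    filter_upwards [isOpen_compl_singleton.mem_nhds hy] with x hx
    exact (potential_of_ne_zero g hx).symm

theorem bddMeas_potential {g : ℝ → ℂ} (hg : Integrable g) (c : ℝ) :
    BddMeas fun y => ((c * potential g y : ℝ) : ℂ) := by
  have := (continuous_potential hg).measurable
  refine ⟨by fun_prop, |c| * ∫ x, ‖g x‖, fun y => ?_⟩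
  rw [Complex.norm_real, Real.norm_eq_abs, abs_mul]
  exact mul_le_mul_of_nonneg_left (abs_potential_le g y) (abs_nonneg c)

theorem coeFn_invertedFourier_convOp (lam : ℝ) {g : ℝ → ℂ} (hg : Integrable g)
    (hsymm : ∀ᵐ x : ℝ, g (-x) = conj (g x)) (ψ : L2) :
    invertedFourier lam (convOp g hg ψ) =ᵐ[volume]
      fun y => (potential g y : ℂ) * invertedFourier lam ψ y := by
  set Q := (translation lam).trans fourierL2
  have h : Q (convOp g hg ψ) = _ := map_convOp (translation_fourierL2_shift lam) hg ψ
  change inversion (Q (convOp g hg ψ)) =ᵐ[volume] fun y => _ * inversion (Q ψ) y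
  filter_upwards [coeFn_inversion (Q (convOp g hg ψ)), coeFn_inversion (Q ψ),
    quasiMeasurePreserving_inv.ae (coeFn_bmul (bddMeas_fourierInt hg) (Q ψ)), ae_ne_zero]
    with y h1 h2 h3 h4
  rw [h1, h2, h, h3, ofReal_potential hsymm h4]
  ring

/-! ### Diagonalization of the thermal Hamiltonian and of its perturbation -/

theorem mem_unitaryConj_graph (U : L2 ≃ₗᵢ[ℂ] L2) (A : L2 →ₗ.[ℂ] L2) (φ χ : L2) :
    (φ, χ) ∈ (unitaryConj U A).graph ↔ (U φ, U χ) ∈ A.graph := by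
  constructor
  · intro h
    obtain ⟨y, rfl, rfl⟩ := (LinearPMap.mem_graph_iff _).1 h
    refine (LinearPMap.mem_graph_iff _).2 ⟨⟨U y, y.2⟩, rfl, ?_⟩
    exact (U.apply_symm_apply _).symm
  · intro h
    obtain ⟨y, hy, hy'⟩ := (LinearPMap.mem_graph_iff _).1 h
    have hφ : U φ ∈ A.domain := by
      rw [← show (y : L2) = U φ from hy]
      exact y.2
    refine (LinearPMap.mem_graph_iff _).2 ⟨⟨φ, hφ⟩, rfl, ?_⟩
    have : y = ⟨U φ, hφ⟩ := Subtype.ext hy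
    subst this
    exact (congrArg U.symm hy').trans (U.symm_apply_apply χ)

theorem mem_smul_graph {lam : ℂ} (hlam : lam ≠ 0) (A : L2 →ₗ.[ℂ] L2) (φ χ : L2) :
    (φ, χ) ∈ (lam • A).graph ↔ (φ, lam⁻¹ • χ) ∈ A.graph := by
  constructor
  · intro h
    obtain ⟨y, rfl, rfl⟩ := (LinearPMap.mem_graph_iff _).1 h
    refine (LinearPMap.mem_graph_iff _).2 ⟨y, rfl, ?_⟩
    change A y = lam⁻¹ • lam • A y
    rw [inv_smul_smul₀ hlam]
  · intro h
    obtain ⟨y, rfl, hy⟩ := (LinearPMap.mem_graph_iff _).1 h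
    refine (LinearPMap.mem_graph_iff _).2 ⟨y, rfl, ?_⟩
    change lam • A y = χ
    rw [hy]
    exact smul_inv_smul₀ hlam χ

theorem mem_vadd_graph (B : L2 →ₗ[ℂ] L2) (A : L2 →ₗ.[ℂ] L2) (φ χ : L2) :
    (φ, χ) ∈ (B +ᵥ A).graph ↔ (φ, χ - B φ) ∈ A.graph := by
  constructor
  · intro h
    obtain ⟨y, rfl, rfl⟩ := (LinearPMap.mem_graph_iff _).1 h
    refine (LinearPMap.mem_graph_iff _).2 ⟨y, rfl, ?_⟩
    change A y = (B y + A y) - B y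
    rw [add_sub_cancel_left]
  · intro h
    obtain ⟨y, rfl, hy⟩ := (LinearPMap.mem_graph_iff _).1 h
    refine (LinearPMap.mem_graph_iff _).2 ⟨y, rfl, ?_⟩
    change B y + A y = χ
    rw [hy]
    exact add_sub_cancel _ _

theorem mem_thermalHamiltonian_graph {lam : ℝ} (hlam : 0 < lam) (φ χ : L2) :
    (φ, χ) ∈ (thermalHamiltonian lam).graph ↔
      (invertedFourier lam φ, (lam : ℂ)⁻¹ • invertedFourier lam χ) ∈ momentum.graph := by
  rw [thermalHamiltonian, mem_smul_graph (Complex.ofReal_ne_zero.2 hlam.ne'),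
    mem_unitaryConj_graph, piZero_graph, mem_invertedMomentumGraph, map_smul, map_smul]
  rfl

theorem measurable_energy (lam : ℝ) : Measurable fun k : ℝ => lam * (2 * Real.pi * k) := by
  fun_prop

theorem smul_mem_momentum_iff {lam : ℝ} (hlam : 0 < lam) (φ χ : L2) :
    (φ, (lam : ℂ)⁻¹ • χ) ∈ momentum.graph ↔ Lp.fourierTransformₗᵢ ℝ ℂ χ =ᵐ[volume]
      fun k => ((lam * (2 * Real.pi * k) : ℝ) : ℂ) * Lp.fourierTransformₗᵢ ℝ ℂ φ k := by
  have hl : (lam : ℂ) ≠ 0 := Complex.ofReal_ne_zero.2 hlam.ne'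
  rw [diagonalizes_momentum.graph_iff, map_smul]
  have h := Lp.coeFn_smul (lam : ℂ)⁻¹ (Lp.fourierTransformₗᵢ ℝ ℂ χ)
  constructor
  · intro h1
    filter_upwards [h, h1] with k h2 h3
    rw [h2, Pi.smul_apply, smul_eq_mul, inv_mul_eq_iff_eq_mul₀ hl] at h3
    rw [h3]
    push_cast
    ring
  · intro h1
    filter_upwards [h, h1] with k h2 h3
    rw [h2, Pi.smul_apply, smul_eq_mul, inv_mul_eq_iff_eq_mul₀ hl, h3]
    push_cast
    ring

theorem diagonalizes_thermalHamiltonian {lam : ℝ} (hlam : 0 < lam) :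
    Diagonalizes ((invertedFourier lam).trans (Lp.fourierTransformₗᵢ ℝ ℂ))
      (fun k => lam * (2 * Real.pi * k)) (thermalHamiltonian lam) :=
  ⟨measurable_energy lam, fun φ χ => by
    rw [mem_thermalHamiltonian_graph hlam, smul_mem_momentum_iff hlam]
    rfl⟩

/-- The gauge function `G(y) = λ⁻¹ ∫₀^y √(2π) ĝ(1/s) ds`. -/
def gauge (lam : ℝ) (g : ℝ → ℂ) (y : ℝ) : ℝ := ∫ s in (0 : ℝ)..y, lam⁻¹ * potential g s

theorem hasDerivAt_gauge (lam : ℝ) {g : ℝ → ℂ} (hg : Integrable g) (y : ℝ) :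
    HasDerivAt (gauge lam g) (lam⁻¹ * potential g y) y := by
  have hc : Continuous fun s => lam⁻¹ * potential g s := (continuous_potential hg).const_mul _
  exact intervalIntegral.integral_hasDerivAt_right (hc.intervalIntegrable _ _)
    (hc.stronglyMeasurableAtFilter _ _) hc.continuousAt

theorem measurable_gauge (lam : ℝ) {g : ℝ → ℂ} (hg : Integrable g) :
    Measurable (gauge lam g) :=
  (continuous_iff_continuousAt.2 fun y => (hasDerivAt_gauge lam hg y).continuousAt).measurable

/-- The derivative of the gauge function is the potential divided by λ, so conjugation by the phase
absorbs the convolution term exactly and leaves λp. -/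
theorem mem_perturbedHamiltonian_graph {lam : ℝ} (hlam : 0 < lam) {g : ℝ → ℂ} (hg : Integrable g)
    (hsymm : ∀ᵐ x : ℝ, g (-x) = conj (g x)) (φ χ : L2) :
    (φ, χ) ∈ (perturbedHamiltonian lam g hg).graph ↔
      (phase _ (measurable_gauge lam hg) (invertedFourier lam φ),
        (lam : ℂ)⁻¹ • phase _ (measurable_gauge lam hg) (invertedFourier lam χ)) ∈
          momentum.graph := by
  rw [perturbedHamiltonian, mem_vadd_graph, mem_thermalHamiltonian_graph hlam,
    ← (phase _ (measurable_gauge lam hg)).map_smul,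
    phase_mem_momentum_iff (measurable_gauge lam hg) (hasDerivAt_gauge lam hg)
      (bddMeas_potential hg lam⁻¹), map_sub, smul_sub]
  have h : (lam : ℂ)⁻¹ • invertedFourier lam (convOp g hg φ) =
      bmul _ (bddMeas_potential hg lam⁻¹) (invertedFourier lam φ) := by
    refine bmul_congr _ ?_
    filter_upwards [Lp.coeFn_smul (lam : ℂ)⁻¹ (invertedFourier lam (convOp g hg φ)),
      coeFn_invertedFourier_convOp lam hg hsymm φ] with y h1 h2
    rw [h1, Pi.smul_apply, h2, smul_eq_mul]
    push_cast
    ring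
  rw [h]

/-- The multiplier is the same as for the unperturbed operator; the perturbation survives only in
the diagonalizing unitary. -/
theorem diagonalizes_perturbedHamiltonian {lam : ℝ} (hlam : 0 < lam) {g : ℝ → ℂ}
    (hg : Integrable g) (hsymm : ∀ᵐ x : ℝ, g (-x) = conj (g x)) :
    Diagonalizes (((invertedFourier lam).trans (phase _ (measurable_gauge lam hg))).trans
      (Lp.fourierTransformₗᵢ ℝ ℂ)) (fun k => lam * (2 * Real.pi * k))
      (perturbedHamiltonian lam g hg) :=
  ⟨measurable_energy lam, fun φ χ => by
    rw [mem_perturbedHamiltonian_graph hlam hg hsymm, smul_mem_momentum_iff hlam]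
    rfl⟩

theorem quasiMeasurePreserving_energy {lam : ℝ} (hlam : 0 < lam) :
    Measure.QuasiMeasurePreserving (fun k : ℝ => lam * (2 * Real.pi * k)) volume volume := by
  have h0 : lam * (2 * Real.pi) ≠ 0 := by positivity
  have he : (fun k : ℝ => lam * (2 * Real.pi * k)) = fun k => lam * (2 * Real.pi) * k :=
    funext fun k => by ring
  rw [he]
  refine ⟨measurable_const_mul _, ?_⟩
  rw [Real.map_volume_mul_left h0]
  exact Measure.smul_absolutelyContinuous

theorem exists_energy_window {lam : ℝ} (hlam : 0 < lam) (r δ : ℝ) (hδ : 0 < δ) :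
    ∃ S : Set ℝ, MeasurableSet S ∧ volume S ≠ 0 ∧ volume S ≠ ∞ ∧
      ∀ k ∈ S, |lam * (2 * Real.pi * k) - r| ≤ δ := by
  set c := lam * (2 * Real.pi)
  have hc : 0 < c := by positivity
  refine ⟨Set.Icc ((r - δ) / c) ((r + δ) / c), measurableSet_Icc, ?_, ?_, fun k hk => ?_⟩
  · rw [Real.volume_Icc, ENNReal.ofReal_ne_zero_iff, sub_pos]
    gcongr
    linarith
  · rw [Real.volume_Icc]
    exact ENNReal.ofReal_ne_top
  · rw [← mul_assoc]
    have h1 := (div_le_iff₀ hc).1 hk.1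
    have h2 := (le_div_iff₀ hc).1 hk.2
    rw [abs_le]
    constructor <;> nlinarith

/-! ### The propagators -/

/-- An operator diagonalized by `F K` with multiplier `2πλk` generates the translations, conjugated
by `K`. -/
theorem map_propagator_eq_shift {lam : ℝ} {K : L2 ≃ₗᵢ[ℂ] L2} {A : L2 →ₗ.[ℂ] L2}
    (hA : Diagonalizes (K.trans (Lp.fourierTransformₗᵢ ℝ ℂ))
      (fun k => lam * (2 * Real.pi * k)) A) (t : ℝ) (ψ : L2) :
    K (hA.propagator t ψ) = shift (lam * t) (K ψ) := by
  apply (Lp.fourierTransformₗᵢ ℝ ℂ).injective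
  rw [fourier_shift]
  refine Lp.ext ?_
  have h := hA.map_propagator t ψ
  filter_upwards [h, coeFn_phase (measurable_const_mul (-(2 * Real.pi * (lam * t))))
    (Lp.fourierTransformₗᵢ ℝ ℂ (K ψ))] with k h1 h2
  have h1' : Lp.fourierTransformₗᵢ ℝ ℂ (K (hA.propagator t ψ)) k = _ := h1
  rw [h1', h2]
  have h3 : -t * (lam * (2 * Real.pi * k)) = -(2 * Real.pi * (lam * t)) * k := by ring
  rw [h3]
  rfl

theorem phase_shift_shift_phase {G : ℝ → ℝ} (hG : Measurable G) (s : ℝ) (ψ : L2) :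
    (phase G hG).symm (shift (-s) (phase G hG (shift s ψ))) =
      bmul _ (bddMeas_exp ((hG.comp (measurable_add_const s)).sub hG)) ψ := by
  refine bmul_congr _ ?_
  rw [phase_symm_apply]
  filter_upwards [coeFn_bmul (bddMeas_exp hG.neg) (shift (-s) (phase G hG (shift s ψ))),
    coeFn_shift (-s) (phase G hG (shift s ψ)),
    (measurePreserving_sub_right volume (-s)).quasiMeasurePreserving.ae
      (coeFn_phase hG (shift s ψ)),
    (measurePreserving_sub_right volume (-s)).quasiMeasurePreserving.ae
      (coeFn_shift s ψ)] with y h1 h2 h3 h4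
  rw [h1, h2, h3, h4, sub_neg_eq_add, add_sub_cancel_right, ← mul_assoc, ← Complex.exp_add]
  congr 2
  simp only [Pi.neg_apply, Pi.sub_apply, Function.comp_apply]
  push_cast
  ring

/-- The wave operator `K* e^{i(L - G)} K`. -/
def waveOperator (K : L2 ≃ₗᵢ[ℂ] L2) {G : ℝ → ℝ} (hG : Measurable G) (L : ℝ) : L2 ≃ₗᵢ[ℂ] L2 :=
  (K.trans (phase (fun y => L - G y) (measurable_const.sub hG))).trans K.symm

/-- Both groups are translations, so the product of the two evolutions is the multiplication by
exp(i(G(y+λt) - G(y))), which converges as soon as G(y+λt) does for each y. -/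
theorem isWaveOperator_of_tendsto {lam : ℝ} {K : L2 ≃ₗᵢ[ℂ] L2} {A B : L2 →ₗ.[ℂ] L2} {G : ℝ → ℝ}
    (hG : Measurable G)
    (hA : Diagonalizes (K.trans (Lp.fourierTransformₗᵢ ℝ ℂ)) (fun k => lam * (2 * Real.pi * k)) A)
    (hB : Diagonalizes ((K.trans (phase G hG)).trans (Lp.fourierTransformₗᵢ ℝ ℂ))
      (fun k => lam * (2 * Real.pi * k)) B)
    {l : Filter ℝ} [l.IsCountablyGenerated] {L : ℝ}
    (hl : ∀ y, Tendsto (fun t => G (y + lam * t)) l (𝓝 L)) :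
    IsWaveOperator hA.propagator hB.propagator l
      ((waveOperator K hG L).toContinuousLinearEquiv : L2 →L[ℂ] L2) := by
  intro ψ
  have key : ∀ t, hB.propagator (-t) (hA.propagator t ψ) =
      K.symm (bmul _ (bddMeas_exp ((hG.comp (measurable_add_const (lam * t))).sub hG)) (K ψ)) := by
    intro t
    have h1 := map_propagator_eq_shift hB (-t) (hA.propagator t ψ)
    change phase G hG (K _) = shift _ (phase G hG (K _)) at h1
    rw [map_propagator_eq_shift hA, mul_neg] at h1
    rw [← phase_shift_shift_phase hG, ← h1, LinearIsometryEquiv.symm_apply_apply,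
      LinearIsometryEquiv.symm_apply_apply]
  refine Tendsto.congr (fun t => (key t).symm) ((K.symm.continuous.tendsto _).comp ?_)
  refine tendsto_bmul (C := 1) _ (bddMeas_exp (measurable_const.sub hG))
    (fun t y => (Complex.norm_exp_ofReal_mul_I _).le) (fun y => ?_) (K ψ)
  have h2 : Continuous fun r : ℝ => Complex.exp ((r - G y : ℝ) * Complex.I) := by fun_prop
  exact (h2.tendsto L).comp (hl y)

/-- The y-dependent phase G cancels between the adjoint and the operator; only the two asymptotic
constants remain, which is why the S-matrix is a scalar. -/
theorem adjoint_waveOperator_comp (K : L2 ≃ₗᵢ[ℂ] L2) {G : ℝ → ℝ} (hG : Measurable G) (L M : ℝ) :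
    (ContinuousLinearMap.adjoint
      ((waveOperator K hG L).toContinuousLinearEquiv : L2 →L[ℂ] L2)).comp
      ((waveOperator K hG M).toContinuousLinearEquiv : L2 →L[ℂ] L2) =
    Complex.exp ((M - L : ℝ) * Complex.I) • ContinuousLinearMap.id ℂ L2 := by
  ext1 ψ
  refine ext_inner_left ℂ fun η => ?_
  rw [ContinuousLinearMap.comp_apply, ContinuousLinearMap.adjoint_inner_right]
  change inner ℂ (K.symm _) (K.symm _) =
    inner ℂ η (Complex.exp ((M - L : ℝ) * Complex.I) • ψ)
  rw [K.symm.inner_map_map, ← K.inner_map_map η, map_smul, inner_eq_integral, inner_eq_integral]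
  refine integral_congr_ae ?_
  filter_upwards [coeFn_phase (θ := fun y => L - G y) (measurable_const.sub hG) (K η),
    coeFn_phase (θ := fun y => M - G y) (measurable_const.sub hG) (K ψ),
    Lp.coeFn_smul (Complex.exp ((M - L : ℝ) * Complex.I)) (K ψ)] with y h1 h2 h3
  have h1' : (phase (fun y => L - G y) (measurable_const.sub hG)).toLinearEquiv (K η) y = _ := h1
  have h2' : (phase (fun y => M - G y) (measurable_const.sub hG)).toLinearEquiv (K ψ) y = _ := h2
  refine (congrArg₂ (fun a b : ℂ => conj a * b) h1' h2').trans ?_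
  rw [h3, Pi.smul_apply, smul_eq_mul]
  simp only [map_mul]
  rw [← Complex.exp_conj, map_mul, Complex.conj_I, Complex.conj_ofReal]
  have h4 : Complex.exp (((M - L : ℝ) : ℂ) * Complex.I) =
      Complex.exp (((L - G y : ℝ) : ℂ) * -Complex.I) *
        Complex.exp (((M - G y : ℝ) : ℂ) * Complex.I) := by
    rw [← Complex.exp_add]
    congr 1
    push_cast
    ring
  rw [h4]
  ring

/-! ### Integrability of the potential and the scattering phase -/

/-- Large y corresponds to small x = 1/y, where the hypothesis gives decay of order |y|^{-3/2}; for
the remaining y the potential is bounded. -/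
theorem integrable_potential {g : ℝ → ℂ} (hg : Integrable g) {ε C : ℝ} (hε : 0 < ε)
    (hC : ∀ x : ℝ, |x| < ε → ‖gHat g x‖ ≤ C * |x| ^ (3 / 2 : ℝ)) : Integrable (potential g) := by
  have hC0 : 0 ≤ C := by
    have h1 := (norm_nonneg _).trans (hC (ε / 2) (by rw [abs_of_pos (by positivity)]; linarith))
    have h2 : 0 < |ε / 2| ^ (3 / 2 : ℝ) := Real.rpow_pos_of_pos (by positivity) _
    exact nonneg_of_mul_nonneg_left h1 h2
  set M := ∫ x, ‖g x‖
  have hM : 0 ≤ M := integral_nonneg fun _ => norm_nonneg _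
  -- The two summands bound |v|(1 + |y|)^{3/2} for |y| ≤ 1/ε and for |y| > 1/ε respectively.
  set D := M * (1 + ε⁻¹) ^ (3 / 2 : ℝ) + √(2 * Real.pi) * C * (1 + ε) ^ (3 / 2 : ℝ)
  have hI : Integrable fun y : ℝ => D * (1 + ‖y‖) ^ (-(3 / 2 : ℝ)) :=
    (integrable_one_add_norm (by norm_num)).const_mul D
  refine hI.mono' (continuous_potential hg).aestronglyMeasurable (Eventually.of_forall fun y => ?_)
  have hy1 : 0 < 1 + ‖y‖ := by positivity
  rw [Real.norm_eq_abs (potential g y), Real.rpow_neg hy1.le, ← div_eq_mul_inv,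
    le_div_iff₀ (Real.rpow_pos_of_pos hy1 _)]
  by_cases hy : ‖y‖ ≤ ε⁻¹
  · calc |potential g y| * (1 + ‖y‖) ^ (3 / 2 : ℝ) ≤ M * (1 + ε⁻¹) ^ (3 / 2 : ℝ) := by
          gcongr
          exact abs_potential_le g y
      _ ≤ D := le_add_of_nonneg_right (by positivity)
  · have hy' : ε⁻¹ < ‖y‖ := not_le.1 hy
    have hypos : 0 < ‖y‖ := lt_trans (by positivity) hy'
    have hy0 : y ≠ 0 := norm_pos_iff.1 hypos
    have hlt : |y⁻¹| < ε := by
      rw [abs_inv, ← Real.norm_eq_abs]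
      exact inv_lt_of_inv_lt₀ hε hy'
    have h1 := hC y⁻¹ hlt
    have hs : 0 < √(2 * Real.pi) := by positivity
    rw [gHat_eq, norm_mul, Complex.norm_real, Real.norm_of_nonneg (by positivity),
      inv_mul_le_iff₀ hs] at h1
    have h2 : |potential g y| ≤ √(2 * Real.pi) * (C * |y⁻¹| ^ (3 / 2 : ℝ)) := by
      rw [potential_of_ne_zero g hy0]
      exact (Complex.abs_re_le_norm _).trans h1
    have h3 : |y⁻¹| ^ (3 / 2 : ℝ) * (1 + ‖y‖) ^ (3 / 2 : ℝ) ≤ (1 + ε) ^ (3 / 2 : ℝ) := by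
      rw [← Real.mul_rpow (abs_nonneg _) hy1.le]
      refine Real.rpow_le_rpow (by positivity) ?_ (by norm_num)
      rw [mul_add, mul_one, abs_inv, ← Real.norm_eq_abs, inv_mul_cancel₀ hypos.ne', add_comm]
      have : ‖y‖⁻¹ ≤ ε := (inv_lt_of_inv_lt₀ hε hy').le
      linarith
    calc |potential g y| * (1 + ‖y‖) ^ (3 / 2 : ℝ)
        ≤ √(2 * Real.pi) * (C * |y⁻¹| ^ (3 / 2 : ℝ)) * (1 + ‖y‖) ^ (3 / 2 : ℝ) := by gcongr
      _ = √(2 * Real.pi) * C * (|y⁻¹| ^ (3 / 2 : ℝ) * (1 + ‖y‖) ^ (3 / 2 : ℝ)) := by ring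
      _ ≤ √(2 * Real.pi) * C * (1 + ε) ^ (3 / 2 : ℝ) := by gcongr
      _ ≤ D := le_add_of_nonneg_left (by positivity)

theorem gHat_inv_ae {g : ℝ → ℂ} (hsymm : ∀ᵐ x : ℝ, g (-x) = conj (g x)) :
    (fun y => gHat g y⁻¹) =ᵐ[volume]
      fun y => ((√(2 * Real.pi))⁻¹ : ℝ) * (potential g y : ℂ) := by
  filter_upwards [ae_ne_zero] with y hy
  rw [gHat_eq, ofReal_potential hsymm hy]

theorem inv_sq_smul_gHat (g : ℝ → ℂ) :
    (fun x : ℝ => (x ^ 2)⁻¹ • gHat g x) = fun s : ℝ => gHat g s / (s : ℂ) ^ 2 := by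
  ext x
  rw [Complex.real_smul]
  push_cast
  rw [div_eq_inv_mul]

theorem integrable_gHat_div_sq {g : ℝ → ℂ} (hsymm : ∀ᵐ x : ℝ, g (-x) = conj (g x))
    (hv : Integrable (potential g)) : Integrable fun s : ℝ => gHat g s / (s : ℂ) ^ 2 := by
  rw [← inv_sq_smul_gHat, ← integrable_comp_inv_iff, integrable_congr (gHat_inv_ae hsymm)]
  exact hv.ofReal.const_mul _

theorem integral_gHat_div_sq {g : ℝ → ℂ} (hsymm : ∀ᵐ x : ℝ, g (-x) = conj (g x)) :
    ∫ s : ℝ, gHat g s / (s : ℂ) ^ 2 =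
      (((√(2 * Real.pi))⁻¹ * ∫ y, potential g y : ℝ) : ℂ) := by
  rw [← inv_sq_smul_gHat, ← integral_comp_inv, integral_congr_ae (gHat_inv_ae hsymm),
    integral_const_mul, integral_complex_ofReal, Complex.ofReal_mul]

theorem tendsto_gauge_atTop (lam : ℝ) {g : ℝ → ℂ} (hv : Integrable (potential g)) :
    Tendsto (gauge lam g) atTop (𝓝 (∫ y in Set.Ioi 0, lam⁻¹ * potential g y)) :=
  intervalIntegral_tendsto_integral_Ioi 0 (hv.const_mul _).integrableOn tendsto_id

theorem tendsto_gauge_atBot (lam : ℝ) {g : ℝ → ℂ} (hv : Integrable (potential g)) :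
    Tendsto (gauge lam g) atBot (𝓝 (-∫ y in Set.Iic 0, lam⁻¹ * potential g y)) := by
  have h := (intervalIntegral_tendsto_integral_Iic 0
    (hv.const_mul lam⁻¹).integrableOn tendsto_id).neg
  refine h.congr fun y => ?_
  exact (intervalIntegral.integral_symm _ _).symm

end

end Thermal

/-! ### The scattering theorem -/

open Thermal
theorem theorem1p4 (lam : ℝ) (hlam : 0 < lam) (g : ℝ → ℂ) (hg : Integrable g)
    (hsymm : ∀ᵐ x : ℝ, g (-x) = conj (g x)) :
    (perturbedHamiltonian lam g hg).domain = (thermalHamiltonian lam).domain ∧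
    IsSelfAdjoint (perturbedHamiltonian lam g hg) ∧
    ∃ E : PVM L2, E.IsSpectralMeasure (perturbedHamiltonian lam g hg) ∧
      E.acSubspace = ⊤ ∧
      opSpectrum (perturbedHamiltonian lam g hg) = Set.range ((↑) : ℝ → ℂ) ∧
      opSpectrum (part (perturbedHamiltonian lam g hg) E.acSubspace) = Set.range ((↑) : ℝ → ℂ) ∧
      ∃ U V : ℝ → (L2 ≃ₗᵢ[ℂ] L2),
        IsPropagator (thermalHamiltonian lam) U ∧
        IsPropagator (perturbedHamiltonian lam g hg) V ∧
        ∀ ε C : ℝ, 0 < ε → 0 < C →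
          (∀ x : ℝ, |x| < ε → ‖gHat g x‖ ≤ C * |x| ^ (3 / 2 : ℝ)) →
          ∃ Ωp Ωm : L2 →L[ℂ] L2,
            IsWaveOperator U V atTop Ωp ∧ IsWaveOperator U V atBot Ωm ∧
            LinearMap.range (Ωp : L2 →ₗ[ℂ] L2) = E.acSubspace ∧
            LinearMap.range (Ωm : L2 →ₗ[ℂ] L2) = E.acSubspace ∧
            Integrable (fun s : ℝ => gHat g s / (s : ℂ) ^ 2) ∧
            ‖Complex.exp (-Complex.I * (√(2 * Real.pi) / lam : ℝ) *
                ∫ s : ℝ, gHat g s / (s : ℂ) ^ 2)‖ = 1 ∧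
            (ContinuousLinearMap.adjoint Ωp).comp Ωm =
              Complex.exp (-Complex.I * (√(2 * Real.pi) / lam : ℝ) *
                ∫ s : ℝ, gHat g s / (s : ℂ) ^ 2) • ContinuousLinearMap.id ℂ L2 := by
  have hT := diagonalizes_thermalHamiltonian hlam
  have hP := diagonalizes_perturbedHamiltonian hlam hg hsymm
  have hac := hP.acSubspace_eq_top (quasiMeasurePreserving_energy hlam)
  have hspec := hP.opSpectrum_eq (exists_energy_window hlam)
  refine ⟨rfl, hP.isSelfAdjoint, hP.pvm, hP.isSpectralMeasure, hac, hspec,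
    (opSpectrum_part_of_eq_top _ hac).trans hspec, hT.propagator, hP.propagator,
    hT.isPropagator, hP.isPropagator, fun ε C hε _ hC => ?_⟩
  have hv := integrable_potential hg hε hC
  set Lplus := ∫ y in Set.Ioi 0, lam⁻¹ * potential g y with hplus
  set Lminus := -∫ y in Set.Iic 0, lam⁻¹ * potential g y with hminus
  -- `Lplus` and `Lminus` are the limits of the gauge function at +∞ and -∞; the minus sign in
  -- `Lminus` comes from integrating from 0 leftwards, so the two half-line integrals add up.
  have hL : Lminus - Lplus = -(lam⁻¹ * ∫ y, potential g y) := by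
    have hi := hv.const_mul lam⁻¹
    rw [← integral_const_mul, ← intervalIntegral.integral_Iic_add_Ioi (b := 0) hi.integrableOn
      hi.integrableOn, hplus, hminus]
    ring
  have hphase : -Complex.I * (√(2 * Real.pi) / lam : ℝ) * ∫ s : ℝ, gHat g s / (s : ℂ) ^ 2 =
      (Lminus - Lplus : ℝ) * Complex.I := by
    rw [integral_gHat_div_sq hsymm, hL]
    have h2 : √(2 * Real.pi) / lam * ((√(2 * Real.pi))⁻¹ * ∫ y, potential g y) =
        lam⁻¹ * ∫ y, potential g y := by
      have : √(2 * Real.pi) ≠ 0 := by positivity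
      field_simp
    rw [mul_assoc, ← Complex.ofReal_mul, h2]
    push_cast
    ring
  have hrange : ∀ L, LinearMap.range (((waveOperator (invertedFourier lam)
      (measurable_gauge lam hg) L).toContinuousLinearEquiv : L2 →L[ℂ] L2) : L2 →ₗ[ℂ] L2) =
      hP.pvm.acSubspace := fun L => by
    rw [hac, LinearMap.range_eq_top]
    exact (waveOperator _ (measurable_gauge lam hg) L).surjective
  rw [hphase]
  refine ⟨_, _, isWaveOperator_of_tendsto (L := Lplus) (measurable_gauge lam hg) hT hP fun y => ?_,
    isWaveOperator_of_tendsto (L := Lminus) (measurable_gauge lam hg) hT hP fun y => ?_, hrange Lplus,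
    hrange Lminus, integrable_gHat_div_sq hsymm hv, Complex.norm_exp_ofReal_mul_I _,
    adjoint_waveOperator_comp _ _ Lplus Lminus⟩
  · exact (tendsto_gauge_atTop lam hv).comp
      (tendsto_atTop_add_const_left _ y (tendsto_id.const_mul_atTop hlam))
  · exact (tendsto_gauge_atBot lam hv).comp
      (tendsto_atBot_add_const_left _ y (tendsto_id.const_mul_atBot hlam))
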